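/- Let $\kappa$ be an infinite regular cardinal. A category is $\kappa$-lex if it has all limits of diagrams with fewer than $\kappa$ morphisms ("$<\kappa$-limits"); a functor is $\kappa$-lex if it preserves them. A family of arrows with common codomain $x$ is extremal epimorphic if its members do not all factor through a proper subobject of $x$. For a class $K$ of families, $K^{pb}$ is the class of all pullbacks of members of $K$ along arbitrary maps. A continuous $(K,\kappa)$-cotree is a diagram indexed by the opposite of a rooted tree in which every vertex is either a leaf or has predecessors forming a $K$-family (possibly empty), every branch has length $<\kappa$, and the object at each vertex of limit height is the limit of the objects between it and the root. Its family of transfinite cocompositions consists of the projections to the root from the limits along the branches, omitting branches that end at a vertex covered by the empty family. $K^{tree_\kappa}$ is the class of all such families, and $\langle K\rangle_\kappa=(K^{pb})^{tree_\kappa}$. A small $\kappa$-site $(\mathcal C,E)$ is a small $\kappa$-lex category $\mathcal C$ with an arbitrary collection $E$ of families containing $\{\mathrm{id}\colon 1\to 1\}$. $Sh(\mathcal C,\langle E\rangle_\kappa)$ is the category of sheaves of sets for the Grothendieck topology generated by $\langle E\rangle_\kappa$, and $ay\colon\mathcal C\to Sh(\mathcal C,\langle E\rangle_\kappa)$ is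 the Yoneda embedding followed by sheafification. A $\kappa$-topos is a Grothendieck topos $\mathcal E$ which is $(\infty,\kappa)$-coherent: it has $<\kappa$-limits, pullback-stable effective epi–mono factorizations and pullback-stable small unions of subobjects, and, for $K$ the class of all small extremal epimorphic families, all members of $K^{pb}$ and of $\langle K\rangle_\kappa$ are extremal epimorphic. A functor $M\colon\mathcal C\to\mathcal E$ is $E$-preserving if it maps $E$-families to extremal epimorphic families. $Mod_{\mathcal E}(\mathcal C,E,\kappa)$ is the category of $\kappa$-lex $E$-preserving functors $\mathcal C\to\mathcal E$, and $Fun^*(Sh(\mathcal C,\langle E\rangle_\kappa),\mathcal E)$ the category of functors $Sh(\mathcal C,\langle E\rangle_\kappa)\to\mathcal E$ preserving $<\kappa$-limits and all small colimits, both with all natural transformations. **Theorem.** Let $(\mathcal C,E)$ be a small $\kappa$-site and $\mathcal E$ a $\kappa$-topos. 1. For every $\kappa$-lex $E$-preserving functor $M\colon\mathcal C\to\mathcal E$, the unit $\eta\colon M\Rightarrow (Lan_{ay}M)\circ ay$ of the left Kan extension of $M$ along $ay$ is an isomorphism, and $Lan_{ay}M$ is $\kappa$-lex and cocontinuous. 2.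 $Lan_{ay}$ restricts to an equivalence of categories $Mod_{\mathcal E}(\mathcal C,E,\kappa)\to Fun^*(Sh(\mathcal C,\langle E\rangle_\kappa),\mathcal E)$, whose quasi-inverse is precomposition with $ay$. -/

import Mathlib

open CategoryTheory Limits Opposite

universe w v u

namespace KappaTopos

section Basic

variable (κ : Cardinal.{w})

/-- A category is `κ`-lex if it has `< κ`-limits, i.e. limits of all diagrams indexed by
small categories with fewer than `κ` morphisms. -/
class IsLexCategory (C : Type u) [Category.{v} C] : Prop where
  hasLimitsOfShape (J : Type w) [SmallCategory J] (hJ : HasCardinalLT (Arrow J) κ) :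
    HasLimitsOfShape J C

/-- A functor is `κ`-lex if it preserves `< κ`-limits. -/
def IsLexFunctor {C D : Type*} [Category* C] [Category* D] (F : C ⥤ D) : Prop :=
  ∀ (J : Type w) [SmallCategory J], HasCardinalLT (Arrow J) κ →
    Nonempty (PreservesLimitsOfShape J F)

/-- A functor is cocontinuous if it preserves all (`w`-small) colimits. -/
def IsCocontinuous {C D : Type*} [Category* C] [Category* D] (F : C ⥤ D) : Prop :=
  Nonempty (PreservesColimitsOfSize.{w, w} F)

end Basic

section Families

variable {C : Type u} [Category.{v} C]

/-- A family of arrows with common codomain `X` (a `Presieve X`) is extremal epimorphic if its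
members do not all factor through a proper subobject of `X`. -/
def IsExtremalEpic {X : C} (R : Presieve X) : Prop :=
  ∀ ⦃U : C⦄ (m : U ⟶ X) [Mono m],
    (∀ ⦃Y : C⦄ ⦃f : Y ⟶ X⦄, R f → ∃ h : Y ⟶ U, h ≫ m = f) → IsIso m

/-- The class of all small extremal epimorphic families. -/
def extremalEpicFamilies (C : Type u) [Category.{v} C] : Precoverage C where
  coverings X := {R | IsExtremalEpic R ∧
    ∃ (ι : Type w) (Y : ι → C) (f : ∀ i, Y i ⟶ X), R = Presieve.ofArrows Y f}

/-- `K^pb`: all families obtained as the pullback of a `K`-family along some map. -/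
def pullbackClosure (K : Precoverage C) : Precoverage C where
  coverings X := {S | ∃ (Y : C) (f : X ⟶ Y) (ι : Type (max u v)) (Z : ι → C)
    (g : ∀ i, Z i ⟶ Y) (P : ι → C) (p : ∀ i, P i ⟶ X) (q : ∀ i, P i ⟶ Z i),
    Presieve.ofArrows Z g ∈ K Y ∧ (∀ i, IsPullback (p i) (q i) f (g i)) ∧
      S = Presieve.ofArrows P p}

/-- The inclusion of a subset of a poset, as a functor. -/
abbrev inclusion {T : Type w} [PartialOrder T] (S : Set T) : S ⥤ T :=
  Monotone.functor (f := fun s : S => s.1) (fun _ _ h => h)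

/-- For a diagram on the opposite of a poset `T` and `t : T`, the value at `t` as a cone over the
restriction of the diagram to the elements below `t`. -/
@[simps]
def coneBelow {T : Type w} [PartialOrder T] (F : Tᵒᵖ ⥤ C) (t : T) :
    Cone ((inclusion (Set.Iio t)).op ⋙ F) where
  pt := F.obj (op t)
  π :=
    { app := fun s => F.map (homOfLE (Set.mem_Iio.1 s.unop.2).le).op
      naturality := fun _ _ _ =>
        (Category.id_comp _).trans ((congrArg F.map (Subsingleton.elim _ _)).trans
          (F.map_comp _ _)) }

/-- A continuous `(K, κ)`-cotree in `C`: a diagram indexed by the opposite of a rooted tree `T`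
(the root is `⊥`, the predecessors of a vertex in the cotree are its covers in `T`). Every vertex
either is a leaf or its predecessors form a `K`-family (which may be the empty family: this is why
the set of leaves is recorded), every branch has length `< κ`, and the objects
sitting at vertices of limit height are limits. -/
structure ContinuousCotree (K : Precoverage C) (κ : Cardinal.{w}) where
  /-- the underlying tree -/
  T : Type w
  [partialOrder : PartialOrder T]
  [orderBot : OrderBot T]
  isWellOrder_Iio : ∀ t : T, IsWellOrder (Set.Iio t) (· < ·)
  /-- the diagram -/
  diagram : Tᵒᵖ ⥤ C
  /-- the leaves -/
  leaves : Set T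
  isMax_of_mem_leaves : ∀ t ∈ leaves, IsMax t
  covering : ∀ t ∉ leaves,
    Presieve.ofArrows (fun s : {s : T // t ⋖ s} => diagram.obj (op s.1))
      (fun s => diagram.map (homOfLE s.2.le).op) ∈ K (diagram.obj (op t))
  hasCardinalLT_branch : ∀ b : Flag T, HasCardinalLT b κ
  continuous : ∀ t : T, Order.IsSuccLimit t → Nonempty (IsLimit (coneBelow diagram t))

namespace ContinuousCotree

attribute [instance] ContinuousCotree.partialOrder ContinuousCotree.orderBot

variable {K : Precoverage C} {κ : Cardinal.{w}} (D : ContinuousCotree K κ)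

/-- The branches which contribute to the family of transfinite cocompositions: maximal chains,
except for those that end at a vertex covered by the empty family. -/
def Branch : Type w :=
  {b : Flag D.T // ∀ t ∈ b, IsMax t → t ∈ D.leaves}

/-- The root, as an element of a branch. -/
def Branch.root {D : ContinuousCotree K κ} (b : D.Branch) : (b.1 : Set D.T) :=
  ⟨⊥, b.1.bot_mem⟩

/-- The restriction of a cotree to a branch. -/
def branchDiagram (b : D.Branch) : (b.1 : Set D.T)ᵒᵖ ⥤ C :=
  (inclusion (b.1 : Set D.T)).op ⋙ D.diagram

end ContinuousCotree

/-- The families of transfinite cocompositions of the branches of continuous `(K, κ)`-cotrees: the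
transfinite cocomposition of a branch is the projection from the limit along the branch to the
root. -/
inductive IsTreeFamily (K : Precoverage C) (κ : Cardinal.{w}) : ∀ {X : C}, Presieve X → Prop
  | mk (D : ContinuousCotree K κ) (c : ∀ b : D.Branch, LimitCone (D.branchDiagram b)) :
      IsTreeFamily K κ (X := D.diagram.obj (op ⊥))
        (Presieve.ofArrows (fun b : D.Branch => (c b).cone.pt)
          (fun b => (c b).cone.π.app (op b.root)))

/-- `K^{tree_κ}`: the closure of `K` under the `κ`-tree operation. -/
def treeClosure (κ : Cardinal.{w}) (K : Precoverage C) : Precoverage C where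
  coverings _ := {R | IsTreeFamily K κ R}

/-- `⟨K⟩_κ = (K^pb)^{tree_κ}`. -/
def generated (κ : Cardinal.{w}) (K : Precoverage C) : Precoverage C :=
  treeClosure κ (pullbackClosure K)

/-- A class `K` of extremal epimorphic families is compatible with `< κ`-limits if each member is
pullback-stable and continuous `(K^pb, κ)`-cotrees are globally covering. -/
structure IsCompatible (κ : Cardinal.{w}) (K : Precoverage C) : Prop where
  pullback_stable : ∀ ⦃X : C⦄ (R : Presieve X), R ∈ pullbackClosure K X → IsExtremalEpic R
  tree : ∀ ⦃X : C⦄ (R : Presieve X), R ∈ generated κ K X → IsExtremalEpic R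

end Families

section Topos

/-- A Grothendieck topos: a category equivalent to the category of sheaves on a small site. -/
class IsGrothendieckTopos (E : Type u) [Category.{w} E] : Prop where
  exists_equivalence : ∃ (D : Type w) (_ : SmallCategory D) (J : GrothendieckTopology D),
    Nonempty (E ≌ Sheaf J (Type w))

instance (E : Type u) [Category.{w} E] [IsGrothendieckTopos E] : HasColimitsOfSize.{w, w} E := by
  obtain ⟨D, _, J, ⟨e⟩⟩ := IsGrothendieckTopos.exists_equivalence (E := E)
  have : HasColimitsOfSize.{w, w} (Sheaf J (Type w)) :=
    { has_colimits_of_shape := fun _ _ => inferInstance }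
  exact Adjunction.has_colimits_of_equivalence e.functor

theorem hasPullbacks_of_isLexCategory (κ : Cardinal.{w}) [Fact κ.IsRegular]
    (C : Type u) [Category.{v} C] [IsLexCategory κ C] : HasPullbacks C := by
  have h : HasCardinalLT (Arrow (ULiftHom.{w} (ULift.{w} WalkingCospan))) κ :=
    HasCardinalLT.of_le (κ := Cardinal.aleph0.{w})
      ((hasCardinalLT_aleph0_iff _).2 Arrow.finite) (Fact.out : κ.IsRegular).aleph0_le
  have := IsLexCategory.hasLimitsOfShape (κ := κ) (C := C) _ h
  exact hasLimitsOfShape_of_equivalence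
    (ULiftHomULiftCategory.equiv.{w, w} WalkingCospan).symm

/-- `(∞, κ)`-coherent categories. A `κ`-topos is a Grothendieck topos (`IsGrothendieckTopos`) which
is `(∞, κ)`-coherent. -/
structure IsInftyCoherent (κ : Cardinal.{w}) [Fact κ.IsRegular]
    (E : Type u) [Category.{v} E] : Prop where
  /-- `< κ`-limits -/
  isLexCategory : IsLexCategory κ E
  /-- effective epi - mono factorizations -/
  exists_factorization : ∀ ⦃X Y : E⦄ (f : X ⟶ Y), ∃ (I : E) (e : X ⟶ I) (m : I ⟶ Y),
    EffectiveEpi e ∧ Mono m ∧ e ≫ m = f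
  /-- the factorizations are pullback-stable -/
  effectiveEpi_of_isPullback : ∀ ⦃P X Y Z : E⦄ (e' : P ⟶ X) (f' : P ⟶ Z) (f : X ⟶ Y) (e : Z ⟶ Y),
    IsPullback e' f' f e → EffectiveEpi e → EffectiveEpi e'
  /-- pullback-stable small unions of subobjects -/
  exists_union : haveI : HasPullbacks E := hasPullbacks_of_isLexCategory κ E
    ∀ ⦃X : E⦄ (ι : Type w) (s : ι → Subobject X), ∃ t : Subobject X,
      IsLUB (Set.range s) t ∧ ∀ ⦃Y : E⦄ (f : Y ⟶ X),
        IsLUB (Set.range fun i => (Subobject.pullback f).obj (s i)) ((Subobject.pullback f).obj t)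
  /-- small extremal epimorphic families are compatible with `< κ`-limits -/
  isCompatible : IsCompatible κ (extremalEpicFamilies.{w} E)

end Topos

section Sites

variable (κ : Cardinal.{w}) {C : Type w} [SmallCategory C] (K : Precoverage C)

/-- A small `κ`-site: a small `κ`-lex category `C` with an arbitrary collection of families which
contains `{id : 1 ⟶ 1}`. -/
structure IsKappaSite : Prop where
  isLexCategory : IsLexCategory κ C
  id_mem : ∃ T : C, Nonempty (IsTerminal T) ∧ Presieve.singleton (𝟙 T) ∈ K T

/-- The Grothendieck topology whose covers are given by `⟨K⟩_κ`. -/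
abbrev topology : GrothendieckTopology C := (generated κ K).toGrothendieck

/-- `Sh(C, ⟨K⟩_κ)`. -/
abbrev Sh : Type (w + 1) := Sheaf (topology κ K) (Type w)

/-- The sheafified Yoneda embedding `ay`. -/
noncomputable abbrev ay : C ⥤ Sh κ K :=
  yoneda ⋙ presheafToSheaf (topology κ K) (Type w)

variable (E : Type u) [Category.{w} E]

/-- A functor preserves `K` if it maps `K`-families to extremal epimorphic families. -/
def PreservesFamilies {E : Type u} [Category.{w} E] (M : C ⥤ E) : Prop :=
  ∀ ⦃X : C⦄ (R : Presieve X), R ∈ K X → IsExtremalEpic (R.map M)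

/-- The objects of `Mod_E(C, K, κ)`: `κ`-lex `K`-preserving functors `C ⥤ E`. -/
def isModel : ObjectProperty (C ⥤ E) :=
  fun M => IsLexFunctor κ M ∧ PreservesFamilies K M

/-- `Mod_E(C, K, κ)`, with all natural transformations. -/
abbrev Mod := (isModel κ K E).FullSubcategory

/-- The objects of `Fun^*(S, E)`: `κ`-lex cocontinuous functors `S ⥤ E`. -/
def isLexCocontinuous (S : Type*) [Category* S] : ObjectProperty (S ⥤ E) :=
  fun N => IsLexFunctor κ N ∧ IsCocontinuous.{w} N

/-- `Fun^*(S, E)`, with all natural transformations. -/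
abbrev FunStar (S : Type*) [Category* S] := (isLexCocontinuous κ E S).FullSubcategory

instance [HasColimitsOfSize.{w, w} E] (M : C ⥤ E) : (ay κ K).HasLeftKanExtension M :=
  inferInstance

end Sites

end KappaTopos

/-! Let `L` be the cocontinuous extension of `M` along the Yoneda embedding into presheaves on `C`.
Two properties of `L` suffice: it preserves `< κ`-limits, and it inverts the inclusion of every
covering sieve into its representable. Then `L` inverts all local isomorphisms, so the inclusion of
sheaves followed by `L` is a left adjoint, is `κ`-lex and restricts to `M` along `ay`. A
cocontinuous functor on sheaves is the left Kan extension of its restriction along `ay`, because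
Yoneda is dense and sheafification is a localization (`isLeftKanExtension_of_isCocontinuous`). Hence
this functor is the Kan extension of `M`, with invertible unit.

The combinatorial core is that the covering sieves for `⟨K⟩_κ` are exactly those containing the leaf
arrows of a tree cover (`toGrothendieck_treeClosure`): stability comes from pulling back trees,
transitivity from grafting. They are also closed under intersections of fewer than `κ` sieves
(`iInf_mem_treeTopology`), by climbing the given trees one after the other along a well-order. In a
`κ`-topos, compatibility says that the sieves covered by trees of extremal epimorphic families are
extremal epimorphic. So fewer than `κ` local choices can be made simultaneously in `E`.

For finite limits, one embeds `E` in presheaves and uses that left exact functors to sets are flat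
(`preservesFiniteLimits_of_yoneda_comp`). For products, each `L.obj (F i)` is covered by images of
representables; simultaneous local choices, assembled by `κ`-lexness of `M`, show that the product
comparison is monic (`mono_piComparison`) and then invertible (`isIso_piComparison`). For a covering
sieve, `M` carries its tree to a tree in `E`, so the monomorphism obtained by applying `L` to the
sieve inclusion is extremal epimorphic, hence invertible (`isIso_map_functorInclusion`).

Conversely, closure under intersections makes sheafification `κ`-lex, and inverting sieve inclusions
makes restrictions along `ay` preserve `K`-families. The adjunction between Kan extension and
restriction therefore restricts to the two full subcategories, where unit and counit are invertible.
-/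

namespace KappaTopos

/-! ### Diagrams on the opposite of a poset and limits below a vertex. -/

section Restrict

variable {C : Type u} [Category.{v} C] {T : Type w} [PartialOrder T]

/-- The transition maps of a diagram on the opposite of a poset. -/
def restrict (F : Tᵒᵖ ⥤ C) {a b : T} (h : a ≤ b) : F.obj (op b) ⟶ F.obj (op a) :=
  F.map (homOfLE h).op

@[simp]
lemma restrict_refl (F : Tᵒᵖ ⥤ C) (a : T) : restrict F (le_refl a) = 𝟙 _ :=
  F.map_id _

@[simp]
lemma restrict_trans (F : Tᵒᵖ ⥤ C) {a b c : T} (h : a ≤ b) (h' : b ≤ c) :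
    restrict F h' ≫ restrict F h = restrict F (h.trans h') :=
  (F.map_comp _ _).symm

@[simp]
lemma restrict_trans_assoc (F : Tᵒᵖ ⥤ C) {a b c : T} (h : a ≤ b) (h' : b ≤ c) {Z : C}
    (k : F.obj (op a) ⟶ Z) :
    restrict F h' ≫ restrict F h ≫ k = restrict F (h.trans h') ≫ k := by
  rw [← Category.assoc, restrict_trans]

/-- The value of a diagram at `t` is the limit of its values below `t`, in terms of elements. -/
def IsLimitBelow (F : Tᵒᵖ ⥤ C) (t : T) : Prop :=
  ∀ ⦃Z : C⦄ (s : ∀ u, u < t → (Z ⟶ F.obj (op u))),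
    (∀ u v (hu : u < t) (hv : v < t) (h : u ≤ v), s v hv ≫ restrict F h = s u hu) →
    ∃! z : Z ⟶ F.obj (op t), ∀ u (hu : u < t), z ≫ restrict F hu.le = s u hu

lemma isLimitBelow_iff (F : Tᵒᵖ ⥤ C) (t : T) :
    IsLimitBelow F t ↔ Nonempty (IsLimit (coneBelow F t)) := by
  constructor
  · intro h
    have key (s : Cone ((inclusion (Set.Iio t)).op ⋙ F)) :
        ∃! z : s.pt ⟶ F.obj (op t), ∀ u (hu : u < t),
          z ≫ restrict F hu.le = s.π.app (op ⟨u, hu⟩) := by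
      refine h (fun u hu => s.π.app (op ⟨u, hu⟩)) fun u v hu hv huv => ?_
      exact s.w (j := op ⟨v, hv⟩) (j' := op ⟨u, hu⟩)
        (homOfLE (show (⟨u, hu⟩ : Set.Iio t) ≤ ⟨v, hv⟩ from huv)).op
    exact ⟨{ lift := fun s => (key s).choose
             fac := fun s u => (key s).choose_spec.1 u.unop.1 u.unop.2
             uniq := fun s m hm => (key s).choose_spec.2 _ fun u hu => hm (op ⟨u, hu⟩) }⟩
  · rintro ⟨hl⟩ Z s hs
    let c : Cone ((inclusion (Set.Iio t)).op ⋙ F) :=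
      { pt := Z
        π := { app := fun u => s u.unop.1 u.unop.2
               naturality := fun u v f =>
                 (Category.id_comp _).trans
                   (hs v.unop.1 u.unop.1 v.unop.2 u.unop.2 (leOfHom f.unop)).symm } }
    exact ⟨hl.lift c, fun u hu => hl.fac c (op ⟨u, hu⟩), fun z hz =>
      hl.uniq c z fun u => hz u.unop.1 u.unop.2⟩

end Restrict

/-! ### Fibre products of fewer than `κ` arrows. -/

section FiberProduct

variable {C : Type u} [Category.{v} C]

/-- The fibre product of a family of arrows `a i : A i ⟶ X` and of `g : Y ⟶ X`. -/
structure FiberProduct {X Y : C} (g : Y ⟶ X) {I : Type w} {A : I → C} (a : ∀ i, A i ⟶ X) where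
  pt : C
  base : pt ⟶ Y
  proj : ∀ i, pt ⟶ A i
  condition : ∀ i, proj i ≫ a i = base ≫ g
  lift : ∀ {Z : C} (b : Z ⟶ Y) (p : ∀ i, Z ⟶ A i), (∀ i, p i ≫ a i = b ≫ g) → (Z ⟶ pt)
  lift_base : ∀ {Z : C} (b : Z ⟶ Y) (p : ∀ i, Z ⟶ A i) (h : ∀ i, p i ≫ a i = b ≫ g),
    lift b p h ≫ base = b
  lift_proj : ∀ {Z : C} (b : Z ⟶ Y) (p : ∀ i, Z ⟶ A i) (h : ∀ i, p i ≫ a i = b ≫ g) (i : I),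
    lift b p h ≫ proj i = p i
  hom_ext : ∀ {Z : C} {f f' : Z ⟶ pt}, f ≫ base = f' ≫ base →
    (∀ i, f ≫ proj i = f' ≫ proj i) → f = f'

attribute [simp] FiberProduct.lift_base FiberProduct.lift_proj

namespace FiberProduct

variable {X Y : C} {g : Y ⟶ X} {I : Type w} {A : I → C} {a : ∀ i, A i ⟶ X}
  (F : FiberProduct g a)

lemma condition_assoc (i : I) {W : C} (k : X ⟶ W) :
    F.proj i ≫ a i ≫ k = F.base ≫ g ≫ k := by
  rw [← Category.assoc, F.condition, Category.assoc]

variable {Z : C} (b : Z ⟶ Y) (p : ∀ i, Z ⟶ A i) (h : ∀ i, p i ≫ a i = b ≫ g)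

@[simp]
lemma lift_proj_assoc (i : I) {W : C} (k : A i ⟶ W) :
    F.lift b p h ≫ F.proj i ≫ k = p i ≫ k := by
  rw [← Category.assoc, F.lift_proj]

end FiberProduct

variable (κ : Cardinal.{w}) [Fact κ.IsRegular]

lemma aleph0_le_of_fact : Cardinal.aleph0 ≤ κ := (Fact.out : κ.IsRegular).aleph0_le

/-- A thin category with fewer than `κ` objects has fewer than `κ` arrows. -/
lemma hasCardinalLT_arrow_of_isThin (J : Type w) [Category.{v} J] [Quiver.IsThin J]
    (hJ : HasCardinalLT J κ) : HasCardinalLT (Arrow J) κ :=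
  (hasCardinalLT_prod (aleph0_le_of_fact κ) hJ hJ).of_injective
    (fun f => (f.left, f.right)) (by
      rintro ⟨X, Y, f⟩ ⟨X', Y', f'⟩ h
      obtain ⟨rfl, rfl⟩ : X = X' ∧ Y = Y' := by simpa using h
      obtain rfl : f = f' := Subsingleton.elim _ _
      rfl)

lemma hasCardinalLT_option {I : Type w} (hI : HasCardinalLT I κ) :
    HasCardinalLT (Option I) κ :=
  (hasCardinalLT_option_iff I κ (aleph0_le_of_fact κ)).2 hI

lemma hasLimitsOfShape_widePullbackShape [IsLexCategory κ C] {I : Type w}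
    (hI : HasCardinalLT I κ) : HasLimitsOfShape (WidePullbackShape I) C :=
  IsLexCategory.hasLimitsOfShape (κ := κ) _
    (hasCardinalLT_arrow_of_isThin κ _ (hasCardinalLT_option κ hI))

/-- The arrow `g` is treated as one more leg of a wide pullback, indexed by `none`; an empty `I` is
thereby allowed. -/
lemma nonempty_fiberProduct [IsLexCategory κ C] {X Y : C} (g : Y ⟶ X) {I : Type w}
    (hI : HasCardinalLT I κ) {A : I → C} (a : ∀ i, A i ⟶ X) : Nonempty (FiberProduct g a) := by
  have := hasLimitsOfShape_widePullbackShape (C := C) κ (hasCardinalLT_option κ hI)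
  let B : Option I → C := fun o => o.casesOn Y A
  let b : ∀ o, B o ⟶ X := fun o => match o with
    | none => g
    | some i => a i
  have hb {Z : C} (y : Z ⟶ Y) (p : ∀ i, Z ⟶ A i) (h : ∀ i, p i ≫ a i = y ≫ g) (o : Option I) :
      (show Z ⟶ B o from match o with
        | none => y
        | some i => p i) ≫ b o = y ≫ g := by
    cases o with
    | none => rfl
    | some i => exact h i
  refine ⟨⟨widePullback X B b, WidePullback.π b none, fun i => WidePullback.π b (some i),
    fun i => ?_, fun {Z} y p h => WidePullback.lift (y ≫ g) _ (hb y p h), fun y p h => ?_,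
    fun y p h i => ?_, fun {Z f f'} h h' => ?_⟩⟩
  · exact (WidePullback.π_arrow b (some i)).trans (WidePullback.π_arrow b none).symm
  · exact WidePullback.lift_π b _ _ (hb y p h) none
  · exact WidePullback.lift_π b _ _ (hb y p h) (some i)
  · refine WidePullback.hom_ext _ _ _ (fun o => ?_) ?_
    · cases o with
      | none => exact h
      | some i => exact h' i
    · have e := WidePullback.π_arrow b none
      rw [← e, reassoc_of% h]

end FiberProduct

lemma isPullback_of_exists_lift {C : Type u} [Category.{v} C] {P X Y Z : C} {fst : P ⟶ X}
    {snd : P ⟶ Y} {f : X ⟶ Z} {g : Y ⟶ Z} (w : fst ≫ f = snd ≫ g)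
    (ex : ∀ ⦃W : C⦄ (a : W ⟶ X) (b : W ⟶ Y), a ≫ f = b ≫ g →
      ∃ l : W ⟶ P, l ≫ fst = a ∧ l ≫ snd = b)
    (ext : ∀ ⦃W : C⦄ (l l' : W ⟶ P), l ≫ fst = l' ≫ fst → l ≫ snd = l' ≫ snd → l = l') :
    IsPullback fst snd f g :=
  ⟨⟨w⟩, ⟨PullbackCone.IsLimit.mk w (fun c => (ex c.fst c.snd c.condition).choose)
    (fun c => (ex c.fst c.snd c.condition).choose_spec.1)
    (fun c => (ex c.fst c.snd c.condition).choose_spec.2)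
    (fun c _ h₁ h₂ => ext _ _ (h₁.trans (ex c.fst c.snd c.condition).choose_spec.1.symm)
      (h₂.trans (ex c.fst c.snd c.condition).choose_spec.2.symm))⟩⟩

/-! ### Closure properties of `K^pb`. -/

section Precoverages

variable {C : Type u} [Category.{v} C] {K : Precoverage C}

lemma exists_isPullback_of_ofArrows_eq {X Y : C} {k : X ⟶ Y} {ι ι' : Type*} {P : ι → C}
    {p : ∀ i, P i ⟶ X} {P' : ι' → C} {p' : ∀ i, P' i ⟶ X} {Z : ι' → C} {l : ∀ j, Z j ⟶ Y}
    {q : ∀ j, P' j ⟶ Z j} (e : Presieve.ofArrows P p = Presieve.ofArrows P' p')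
    (hq : ∀ j, IsPullback (p' j) (q j) k (l j)) (i : ι) :
    ∃ (j : ι') (r : P i ⟶ Z j), IsPullback (p i) r k (l j) := by
  obtain ⟨j, hj, hj'⟩ := Presieve.ofArrows_surj _ _ (e ▸ Presieve.ofArrows.mk i :
    Presieve.ofArrows P' p' (p i))
  refine ⟨j, eqToHom hj.symm ≫ q j, ?_⟩
  rw [hj']
  exact (hq j).of_iso (eqToIso hj) (Iso.refl _) (Iso.refl _) (Iso.refl _)
    (by simp) (by simp) (by simp) (by simp)

instance : (pullbackClosure K).IsStableUnderBaseChange where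
  mem_coverings_of_isPullback {ι S X} f hf {Y} g P p₁ p₂ h := by
    obtain ⟨Z, k, ι', W, l, Q, q₁, q₂, hl, hq, e⟩ := hf
    -- An equality of presieves does not match the two index types. Both project surjectively from
    -- the type of matching pairs, so reindexing over it changes neither family.
    let α := {x : ι × ι' // ∃ r, IsPullback (f x.1) r k (l x.2)}
    have h₁ : Function.Surjective (fun x : α => x.1.1) := fun i => by
      obtain ⟨j, r, hr⟩ := exists_isPullback_of_ofArrows_eq e hq i
      exact ⟨⟨(i, j), r, hr⟩, rfl⟩
    have h₂ : Function.Surjective (fun x : α => x.1.2) := fun j => by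
      obtain ⟨i, hi, hi'⟩ := Presieve.ofArrows_surj _ _ (e.symm ▸ Presieve.ofArrows.mk j :
        Presieve.ofArrows X f (q₁ j))
      refine ⟨⟨(i, j), eqToHom hi ≫ q₂ j, ?_⟩, rfl⟩
      exact (hq j).of_iso (eqToIso hi.symm) (Iso.refl _) (Iso.refl _) (Iso.refl _)
        (by simp [hi']) (by simp) (by simp) (by simp)
    refine ⟨Z, g ≫ k, α, fun x => W x.1.2, fun x => l x.1.2, fun x => P x.1.1,
      fun x => p₁ x.1.1, fun x => p₂ x.1.1 ≫ x.2.choose, ?_, fun x => ?_, ?_⟩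
    · exact (Presieve.ofArrows_comp_eq_of_surjective l h₂).symm ▸ hl
    · exact ((h x.1.1).flip.paste_horiz x.2.choose_spec.flip).flip
    · exact (Presieve.ofArrows_comp_eq_of_surjective p₁ h₁).symm

lemma le_pullbackClosure : K ≤ pullbackClosure K := fun X R hR => by
  obtain ⟨ι, Y, f, rfl⟩ := R.exists_eq_ofArrows
  exact ⟨X, 𝟙 X, ι, Y, f, Y, f, fun i => 𝟙 _, hR,
    fun i => IsPullback.of_vert_isIso ⟨by simp⟩, rfl⟩

/-- An isomorphism with codomain `X` is a pullback of `𝟙 T` along `X ⟶ T`. This is the role of the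
family `{id : 1 ⟶ 1}` in a `κ`-site. -/
lemma hasIsos_pullbackClosure {T : C} (hT : IsTerminal T) (h : Presieve.singleton (𝟙 T) ∈ K T) :
    (pullbackClosure K).HasIsos where
  mem_coverings_of_isIso {S X} f _ := by
    refine ⟨T, hT.from X, PUnit, fun _ => T, fun _ => 𝟙 T, fun _ => S, fun _ => f,
      fun _ => hT.from S, by rwa [Presieve.ofArrows_pUnit], fun _ => ?_, by
        rw [Presieve.ofArrows_pUnit]⟩
    exact IsPullback.of_horiz_isIso ⟨hT.hom_ext _ _⟩

end Precoverages

end KappaTopos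

/-! ### Tree covers. -/

namespace KappaTopos

variable {C : Type u} [Category.{v} C]

/-- A continuous `(Q, κ)`-cotree with root `X` in which every chain has an upper bound, so that the
branches which contribute to the transfinite cocompositions are those which end at a leaf. -/
structure TreeCover (Q : Precoverage C) (κ : Cardinal.{w}) (X : C) where
  /-- the underlying tree -/
  T : Type w
  [partialOrder : PartialOrder T]
  [orderBot : OrderBot T]
  [wellFoundedLT : WellFoundedLT T]
  le_total_of_le : ∀ {a b t : T}, a ≤ t → b ≤ t → a ≤ b ∨ b ≤ a
  hasCardinalLT_of_isChain : ∀ c : Set T, IsChain (· ≤ ·) c → HasCardinalLT c κ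
  bddAbove_of_isChain : ∀ c : Set T, IsChain (· ≤ ·) c → BddAbove c
  /-- the diagram -/
  diagram : Tᵒᵖ ⥤ C
  /-- the identification of the root -/
  root : diagram.obj (op ⊥) ≅ X
  /-- the leaves -/
  leaves : Set T
  isMax_of_mem_leaves : ∀ t ∈ leaves, IsMax t
  covering : ∀ t ∉ leaves,
    Presieve.ofArrows (fun s : {s : T // t ⋖ s} => diagram.obj (op s.1))
      (fun s => restrict diagram s.2.le) ∈ Q (diagram.obj (op t))
  continuous : ∀ t : T, Order.IsSuccLimit t → IsLimitBelow diagram t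

namespace TreeCover

attribute [instance] TreeCover.partialOrder TreeCover.orderBot TreeCover.wellFoundedLT

variable {Q : Precoverage C} {κ : Cardinal.{w}} {X Y : C}

/-- The arrow from the object at a vertex to the root. -/
def str (D : TreeCover Q κ X) (t : D.T) : D.diagram.obj (op t) ⟶ X :=
  restrict D.diagram bot_le ≫ D.root.hom

@[simp]
lemma restrict_str (D : TreeCover Q κ X) {a b : D.T} (h : a ≤ b) :
    restrict D.diagram h ≫ D.str a = D.str b := by
  simp [str]

@[simp]
lemma restrict_str_assoc (D : TreeCover Q κ X) {a b : D.T} (h : a ≤ b) {Z : C} (k : X ⟶ Z) :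
    restrict D.diagram h ≫ D.str a ≫ k = D.str b ≫ k := by
  rw [← Category.assoc, restrict_str]

lemma eq_of_mem_leaves (D : TreeCover Q κ X) {a b : D.T} (ha : a ∈ D.leaves) (h : a ≤ b) :
    a = b :=
  le_antisymm h (D.isMax_of_mem_leaves a ha h)

lemma exists_covBy_le {T : Type w} [PartialOrder T] [WellFoundedLT T] {a b : T} (h : a < b) :
    ∃ s, a ⋖ s ∧ s ≤ b := by
  obtain ⟨s, ⟨h₁, h₂⟩, h₃⟩ := wellFounded_lt.has_min {u : T | a < u ∧ u ≤ b} ⟨b, h, le_rfl⟩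
  exact ⟨s, ⟨h₁, fun c hac hcs => h₃ c ⟨hac, hcs.le.trans h₂⟩ hcs⟩, h₂⟩

/-- A sieve is covered by a tree if it contains the arrows from the leaves to the root. -/
def Covers (D : TreeCover Q κ X) (S : Sieve X) : Prop := ∀ t ∈ D.leaves, S (D.str t)

/-! ### Lexicographic products of trees. -/

section Product

variable {I : Type w} [LinearOrder I] (D : I → TreeCover Q κ X)

/-- The vertices of the lexicographic product of a family of trees: the `j`-th tree is entered only
after a leaf has been reached in all of the previous ones. -/
structure Node : Type w where
  /-- the components -/
  val : ∀ i, (D i).T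
  mem_leaves : ∀ {i j : I}, i < j → val j ≠ ⊥ → val i ∈ (D i).leaves

namespace Node

variable {D} in
lemma ext_of_forall {f g : Node D} (h : ∀ i, f.1 i = g.1 i) : f = g := by
  cases f
  cases g
  obtain rfl := funext h
  rfl

instance : PartialOrder (Node D) where
  le f g := ∀ i, f.1 i ≤ g.1 i
  le_refl _ _ := le_rfl
  le_trans _ _ _ h h' i := (h i).trans (h' i)
  le_antisymm _ _ h h' := ext_of_forall fun i => le_antisymm (h i) (h' i)

instance : OrderBot (Node D) where
  bot := ⟨fun _ => ⊥, fun _ h => (h rfl).elim⟩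
  bot_le _ _ := bot_le

variable {D}

lemma eq_bot (f : Node D) {i j : I} (hij : i < j) (h : f.1 i ∉ (D i).leaves) : f.1 j = ⊥ := by
  by_contra h'
  exact h (f.mem_leaves hij h')

omit [LinearOrder I] in
lemma notMem_leaves_of_lt {i : I} {a b : (D i).T} (h : a < b) : a ∉ (D i).leaves :=
  fun h' => h.ne ((D i).eq_of_mem_leaves h' h.le)

/-- The index of the tree in which a vertex of the product moves. -/
def IsActive (f : Node D) (i : I) : Prop :=
  f.1 i ∉ (D i).leaves ∧ ∀ k < i, f.1 k ∈ (D k).leaves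

/-- Moving to the vertex `s` in the active tree. -/
def move (f : Node D) (i : I) (h₁ : ∀ k < i, f.1 k ∈ (D k).leaves) (h₂ : ∀ k, i < k → f.1 k = ⊥)
    (s : (D i).T) : Node D :=
  ⟨Function.update f.1 i s, fun {a b} hab hb => by
    by_cases hbi : b = i
    · subst hbi
      rw [Function.update_of_ne hab.ne]
      exact h₁ a hab
    · rw [Function.update_of_ne hbi] at hb
      have hbi' : b < i := lt_of_le_of_ne (not_lt.1 fun h => hb (h₂ b h)) hbi
      rw [Function.update_of_ne (hab.trans hbi').ne]
      exact h₁ a (hab.trans hbi')⟩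

section move

variable (f : Node D) (i : I) (h₁ : ∀ k < i, f.1 k ∈ (D k).leaves) (h₂ : ∀ k, i < k → f.1 k = ⊥)

@[simp]
lemma move_self (s : (D i).T) : (f.move i h₁ h₂ s).1 i = s := Function.update_self ..

lemma move_of_ne (s : (D i).T) {k : I} (h : k ≠ i) : (f.move i h₁ h₂ s).1 k = f.1 k :=
  Function.update_of_ne h ..

lemma move_le {s : (D i).T} {g : Node D} (hs : s ≤ g.1 i) (hg : ∀ k, k ≠ i → f.1 k ≤ g.1 k) :
    f.move i h₁ h₂ s ≤ g := fun k => by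
  by_cases hk : k = i
  · subst hk
    simpa using hs
  · rw [move_of_ne _ _ _ _ _ hk]
    exact hg k hk

lemma le_move {s : (D i).T} {g : Node D} (hs : g.1 i ≤ s) (hg : ∀ k, k ≠ i → g.1 k ≤ f.1 k) :
    g ≤ f.move i h₁ h₂ s := fun k => by
  by_cases hk : k = i
  · subst hk
    simpa using hs
  · rw [move_of_ne _ _ _ _ _ hk]
    exact hg k hk

lemma covBy_move {s : (D i).T} (hs : f.1 i ⋖ s) : f ⋖ f.move i h₁ h₂ s := by
  refine ⟨lt_of_le_of_ne (le_move _ _ _ _ hs.le fun _ _ => le_rfl) fun h => hs.lt.ne ?_,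
    fun g hfg hgm => ?_⟩
  · conv_lhs => rw [h]
    simp
  · have hk (k : I) (hk : k ≠ i) : g.1 k = f.1 k :=
      le_antisymm ((hgm.le k).trans_eq (move_of_ne f i h₁ h₂ s hk)) (hfg.le k)
    have h₃ : f.1 i ≤ g.1 i := hfg.le i
    have h₄ : g.1 i ≤ s := (hgm.le i).trans_eq (move_self ..)
    rcases hs.eq_or_eq h₃ h₄ with h | h
    · refine hfg.ne (ext_of_forall fun k => ?_)
      by_cases hki : k = i
      · subst hki; exact h.symm
      · exact (hk k hki).symm
    · refine hgm.ne (ext_of_forall fun k => ?_)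
      by_cases hki : k = i
      · subst hki; simpa using h
      · rw [move_of_ne _ _ _ _ _ hki]; exact hk k hki

end move

variable [WellFoundedLT I]

lemma exists_isActive {f : Node D} (h : ∃ i, f.1 i ∉ (D i).leaves) : ∃ i, f.IsActive i := by
  obtain ⟨i, hi, hi'⟩ := wellFounded_lt.has_min {i : I | f.1 i ∉ (D i).leaves} h
  exact ⟨i, hi, fun k hk => by_contra fun h => hi' k h hk⟩

lemma exists_first_ne {f g : Node D} (h : f ≠ g) :
    ∃ i, f.1 i ≠ g.1 i ∧ ∀ k < i, f.1 k = g.1 k := by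
  have : ∃ i, f.1 i ≠ g.1 i := by
    by_contra! h'
    exact h (ext_of_forall h')
  obtain ⟨i, hi, hi'⟩ := wellFounded_lt.has_min {i : I | f.1 i ≠ g.1 i} this
  exact ⟨i, hi, fun k hk => by_contra fun h => hi' k h hk⟩

omit [WellFoundedLT I] in
-- Since `f.1 i` lies strictly below something it is not a leaf, so all later coordinates of `f` are
-- still `⊥`.
lemma le_of_first_lt {f g : Node D} {i : I} (hi : f.1 i < g.1 i) (h : ∀ k < i, f.1 k = g.1 k) :
    f ≤ g := fun k => by
  rcases lt_trichotomy k i with hk | rfl | hk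
  · exact (h k hk).le
  · exact hi.le
  · rw [f.eq_bot hk (notMem_leaves_of_lt hi)]
    exact bot_le

lemma le_total_of_le {f g h : Node D} (hf : f ≤ h) (hg : g ≤ h) : f ≤ g ∨ g ≤ f := by
  by_cases hfg : f = g
  · exact Or.inl hfg.le
  obtain ⟨i, hi, hi'⟩ := exists_first_ne hfg
  rcases (D i).le_total_of_le (hf i) (hg i) with h | h
  · exact Or.inl (le_of_first_lt (lt_of_le_of_ne h hi) hi')
  · exact Or.inr (le_of_first_lt (lt_of_le_of_ne h hi.symm) fun k hk => (hi' k hk).symm)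

lemma exists_isActive_of_lt {f g : Node D} (h : f < g) :
    ∃ i, f.IsActive i ∧ f.1 i < g.1 i := by
  obtain ⟨i, hi, hi'⟩ := exists_first_ne h.ne
  have hlt : f.1 i < g.1 i := lt_of_le_of_ne (h.le i) hi
  refine ⟨i, ⟨notMem_leaves_of_lt hlt, fun k hk => ?_⟩, hlt⟩
  rw [hi' k hk]
  exact g.mem_leaves hk (fun h' => (not_lt_bot (h' ▸ hlt)).elim)

/-- Minimize first the active index, then the vertex in that tree. If no node of the set has an
active index, none lies strictly below another node. -/
instance : WellFoundedLT (Node D) := by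
  refine ⟨WellFounded.wellFounded_iff_has_min.2 fun A hA => ?_⟩
  by_cases hA' : ∃ i, ∃ g ∈ A, IsActive g i
  · obtain ⟨i, ⟨g₀, hg₀, hg₀'⟩, hi⟩ := wellFounded_lt.has_min {i | ∃ g ∈ A, IsActive g i} hA'
    obtain ⟨_, ⟨g, ⟨hg, hg'⟩, rfl⟩, ht⟩ := wellFounded_lt.has_min
      ((fun g : Node D => g.1 i) '' {g | g ∈ A ∧ IsActive g i}) ⟨_, g₀, ⟨hg₀, hg₀'⟩, rfl⟩
    refine ⟨g, hg, fun f hf hfg => ?_⟩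
    obtain ⟨k, hk, hk'⟩ := exists_isActive_of_lt hfg
    rcases lt_trichotomy k i with h | rfl | h
    · exact hi k ⟨f, hf, hk⟩ h
    · exact ht _ ⟨f, ⟨hf, hk⟩, rfl⟩ hk'
    · exact hg'.1 (g.mem_leaves h fun h' => (not_lt_bot (h' ▸ hk')).elim)
  · obtain ⟨g, hg⟩ := hA
    refine ⟨g, hg, fun f hf hfg => hA' ?_⟩
    obtain ⟨k, hk, -⟩ := exists_isActive_of_lt hfg
    exact ⟨k, f, hf, hk⟩

omit [WellFoundedLT I] in
lemma eq_of_isActive {f g : Node D} {i : I} (hf : f.IsActive i) (hg : g.IsActive i)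
    (h : f.1 i = g.1 i) (hle : f ≤ g) : f = g := ext_of_forall fun k => by
  rcases lt_trichotomy k i with hk | rfl | hk
  · exact (D k).eq_of_mem_leaves (hf.2 k hk) (hle k)
  · exact h
  · rw [f.eq_bot hk hf.1, g.eq_bot hk hg.1]

omit [WellFoundedLT I] in
lemma isChain_image {c : Set (Node D)} (hc : IsChain (· ≤ ·) c) (i : I) :
    IsChain (· ≤ ·) ((fun g : Node D => g.1 i) '' c) := by
  rintro _ ⟨a, ha, rfl⟩ _ ⟨b, hb, rfl⟩ -
  rcases hc.total ha hb with h | h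
  · exact Or.inl (h i)
  · exact Or.inr (h i)

/-- Inside a chain a node is determined by its active index and its vertex there, and at most one
node has no active index. Regularity of `κ` bounds the resulting sum of chains. -/
lemma hasCardinalLT_of_isChain [Fact κ.IsRegular] (hI : HasCardinalLT I κ) (c : Set (Node D))
    (hc : IsChain (· ≤ ·) c) : HasCardinalLT c κ := by
  have hc' (i : I) : HasCardinalLT ((fun g : Node D => g.1 i) '' c) κ :=
    (D i).hasCardinalLT_of_isChain _ (Node.isChain_image hc i)
  classical
  let φ (g : c) : Option (Σ i, ((fun g : Node D => g.1 i) '' c)) :=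
    if h : ∃ i, g.1.IsActive i then some ⟨h.choose, g.1.1 h.choose, g.1, g.2, rfl⟩ else none
  have hle {f g : c} (h : φ f = φ g) (hfg : f.1 ≤ g.1) : f = g := by
    apply Subtype.ext
    by_cases hf : ∃ i, f.1.IsActive i <;> by_cases hg : ∃ i, g.1.IsActive i
    · simp only [φ, hf, hg, ↓reduceDIte, Option.some.injEq, Sigma.mk.injEq] at h
      have hi := hf.choose_spec
      have hj := hg.choose_spec
      generalize hf.choose = i at h hi
      generalize hg.choose = j at h hj
      obtain ⟨rfl, h⟩ := h
      replace h := congrArg Subtype.val (eq_of_heq h)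
      exact eq_of_isActive hi hj h hfg
    · simp [φ, hf, hg] at h
    · simp [φ, hf, hg] at h
    · by_contra hne
      obtain ⟨i, hi, -⟩ := exists_isActive_of_lt (lt_of_le_of_ne hfg hne)
      exact hf ⟨i, hi⟩
  refine (hasCardinalLT_option κ (hasCardinalLT_sigma _ κ hI hc')).of_injective φ fun f g h => ?_
  rcases hc.total f.2 g.2 with h' | h'
  · exact hle h h'
  · exact (hle h.symm h').symm

omit [WellFoundedLT I] in
lemma bddAbove_of_isChain (c : Set (Node D)) (hc : IsChain (· ≤ ·) c) : BddAbove c := by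
  -- A coordinate that the chain never enters must be bounded by `⊥` itself: any other value would
  -- require leaves at all earlier coordinates.
  have key (i : I) : ∃ u : (D i).T, (∀ g ∈ c, g.1 i ≤ u) ∧ (u ≠ ⊥ → ∃ g ∈ c, g.1 i ≠ ⊥) := by
    by_cases h : ∃ g ∈ c, g.1 i ≠ ⊥
    · obtain ⟨u, hu⟩ := (D i).bddAbove_of_isChain ((fun g : Node D => g.1 i) '' c)
        (Node.isChain_image hc i)
      exact ⟨u, fun g hg => hu ⟨g, hg, rfl⟩, fun _ => h⟩
    · push Not at h
      exact ⟨⊥, fun g hg => (h g hg).le, fun h => (h rfl).elim⟩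
  choose u hu hu' using key
  refine ⟨⟨u, fun {i j} hij hj => ?_⟩, fun g hg i => hu i g hg⟩
  obtain ⟨g, hg, hgj⟩ := hu' j hj
  have := g.mem_leaves hij hgj
  rwa [← (D i).eq_of_mem_leaves this (hu i g hg)]

lemma exists_move_of_covBy {f g : Node D} {i : I} (hf : f.IsActive i) (h : f ⋖ g) :
    ∃ s, f.1 i ⋖ s ∧ g = f.move i hf.2 (fun _ hk => f.eq_bot hk hf.1) s := by
  obtain ⟨k, hk, hk'⟩ := exists_isActive_of_lt h.lt
  obtain rfl : k = i := by
    rcases lt_trichotomy k i with h | h | h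
    · exact (hk.1 (hf.2 k h)).elim
    · exact h
    · exact (hf.1 (hk.2 i h)).elim
  obtain ⟨s, hs, hs'⟩ := exists_covBy_le hk'
  refine ⟨s, hs, ?_⟩
  have h₁ := covBy_move f k hf.2 (fun _ hk => f.eq_bot hk hf.1) hs
  rcases h.eq_or_eq h₁.le (move_le _ _ _ _ hs' fun k _ => h.le k) with h' | h'
  · exact (h₁.ne h'.symm).elim
  · exact h'.symm

end Node

variable {D}
variable {g : Y ⟶ X} (P : ∀ f : Node D, FiberProduct g (fun i => (D i).str (f.1 i)))

/-- The diagram of the product of a family of trees. -/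
abbrev prodDiagram : (Node D)ᵒᵖ ⥤ C where
  obj f := (P f.unop).pt
  map {f f'} φ := (P f'.unop).lift (P f.unop).base
    (fun i => (P f.unop).proj i ≫ restrict (D i).diagram (leOfHom φ.unop i))
    fun i => by simp [(P f.unop).condition]
  map_id f := (P f.unop).hom_ext (by simp) fun i => by simp
  map_comp φ ψ := (P _).hom_ext (by simp) fun i => by simp

@[simp]
lemma restrict_prodDiagram_base {f f' : Node D} (h : f ≤ f') :
    restrict (prodDiagram P) h ≫ (P f).base = (P f').base :=
  (P f).lift_base ..

@[simp]
lemma restrict_prodDiagram_proj {f f' : Node D} (h : f ≤ f') (i : I) :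
    restrict (prodDiagram P) h ≫ (P f).proj i =
      (P f').proj i ≫ restrict (D i).diagram (h i) :=
  ((P f).lift_proj _ _ _ i :)

@[simp]
lemma restrict_prodDiagram_proj_assoc {f f' : Node D} (h : f ≤ f') (i : I) {Z : C}
    (k : (D i).diagram.obj (op (f.1 i)) ⟶ Z) :
    restrict (prodDiagram P) h ≫ (P f).proj i ≫ k =
      (P f').proj i ≫ restrict (D i).diagram (h i) ≫ k := by
  rw [← Category.assoc, restrict_prodDiagram_proj, Category.assoc]

/-- Only the `i`-th factor of the fibre product changes, so an arrow to the new fibre product is an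
arrow to the old one with a lift of its `i`-th component. -/
lemma isPullback_prodDiagram (f : Node D) (i : I) (h₁ : ∀ k < i, f.1 k ∈ (D k).leaves)
    (h₂ : ∀ k, i < k → f.1 k = ⊥) {s : (D i).T} (hs : f.1 i ≤ s) (h : f ≤ f.move i h₁ h₂ s) :
    IsPullback (restrict (prodDiagram P) h)
      ((P (f.move i h₁ h₂ s)).proj i ≫ restrict (D i).diagram (Node.move_self f i h₁ h₂ s).ge)
      ((P f).proj i) (restrict (D i).diagram hs) := by
  have hm (k : I) (hk : k ≠ i) : (f.move i h₁ h₂ s).1 k ≤ f.1 k :=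
    (Node.move_of_ne f i h₁ h₂ s hk).le
  have key {Z : C} (a : Z ⟶ (P f).pt) (b : Z ⟶ (D i).diagram.obj (op s))
      (hab : a ≫ (P f).proj i = b ≫ restrict (D i).diagram hs) :
      ∃ p : ∀ k, Z ⟶ (D k).diagram.obj (op ((f.move i h₁ h₂ s).1 k)),
        p i = b ≫ restrict (D i).diagram (Node.move_self f i h₁ h₂ s).le ∧
        ∀ k (hk : k ≠ i), p k = a ≫ (P f).proj k ≫ restrict (D k).diagram (hm k hk) := by
    classical
    refine ⟨fun k => if hk : k = i then
        (by subst hk; exact b ≫ restrict (D k).diagram (Node.move_self f k h₁ h₂ s).le) else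
        a ≫ (P f).proj k ≫ restrict (D k).diagram (hm k hk), by simp, fun k hk => by simp [hk]⟩
  refine isPullback_of_exists_lift (by rw [restrict_prodDiagram_proj, Category.assoc,
    restrict_trans]) (fun Z a b hab => ?_) (fun Z l l' h₃ h₄ => ?_)
  · obtain ⟨p, hp, hp'⟩ := key a b hab
    have hpf (k : I) : p k ≫ restrict (D k).diagram (h k) = a ≫ (P f).proj k := by
      by_cases hk : k = i
      · subst hk
        rw [hp, hab, Category.assoc, restrict_trans]
      · rw [hp' k hk]
        simp
    refine ⟨(P (f.move i h₁ h₂ s)).lift (a ≫ (P f).base) p fun k => ?_,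
      (P f).hom_ext (by simp) fun k => ?_, ?_⟩
    · rw [← (D k).restrict_str (h k), reassoc_of% (hpf k), (P f).condition, Category.assoc]
    · rw [Category.assoc, restrict_prodDiagram_proj, FiberProduct.lift_proj_assoc, hpf]
    · rw [FiberProduct.lift_proj_assoc, hp, Category.assoc, restrict_trans, restrict_refl,
        Category.comp_id]
  · refine (P _).hom_ext ?_ fun k => ?_
    · rw [← restrict_prodDiagram_base P h, reassoc_of% h₃]
    · by_cases hk : k = i
      · subst hk
        have := h₄ =≫ restrict (D k).diagram (Node.move_self f k h₁ h₂ s).le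
        simpa only [Category.assoc, restrict_trans, restrict_refl, Category.comp_id] using this
      · have := (h₃ =≫ (P f).proj k) =≫ restrict (D k).diagram (hm k hk)
        simpa only [Category.assoc, restrict_prodDiagram_proj, restrict_prodDiagram_proj_assoc,
          restrict_trans, restrict_refl, Category.comp_id] using this

/-- The covers of `f` are its moves to the covers of its vertex in the active tree, so the family is
a base change of the covering family there. -/
lemma prodDiagram_covering [Q.IsStableUnderBaseChange] [WellFoundedLT I] (f : Node D)
    (hf : ∃ i, f.1 i ∉ (D i).leaves) :
    Presieve.ofArrows (fun s : {s : Node D // f ⋖ s} => (prodDiagram P).obj (op s.1))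
      (fun s => restrict (prodDiagram P) s.2.le) ∈ Q ((prodDiagram P).obj (op f)) := by
  obtain ⟨i, hi⟩ := Node.exists_isActive hf
  have h₂ : ∀ k, i < k → f.1 k = ⊥ := fun _ hk => f.eq_bot hk hi.1
  let φ : {t : (D i).T // f.1 i ⋖ t} → {s : Node D // f ⋖ s} := fun t =>
    ⟨f.move i hi.2 h₂ t.1, f.covBy_move i hi.2 h₂ t.2⟩
  have hφ : Function.Surjective φ := by
    rintro ⟨s, hs⟩
    obtain ⟨t, ht, rfl⟩ := Node.exists_move_of_covBy hi hs
    exact ⟨⟨t, ht⟩, rfl⟩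
  rw [← Presieve.ofArrows_comp_eq_of_surjective _ hφ]
  exact Precoverage.mem_coverings_of_isPullback _ ((D i).covering (f.1 i) hi.1) ((P f).proj i) _ _
    fun t => isPullback_prodDiagram P f i hi.2 h₂ t.2.le (φ t).2.le

/-- Lifts are built coordinatewise. Either the value `f.1 i` is attained strictly below `f`, and the
lift is read off there, or `i` is the coordinate still climbing at `f`, and `f.1 i` is a limit
vertex of `D i`. -/
lemma prodDiagram_isLimitBelow [WellFoundedLT I] (f : Node D) (hf : Order.IsSuccLimit f) :
    IsLimitBelow (prodDiagram P) f := by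
  intro Z s hs
  have hbot : ⊥ < f := hf.bot_lt
  have compat (i : I) {a b : Node D} (ha : a < f) (hb : b < f) {u : (D i).T} (hua : u ≤ a.1 i)
      (hub : u ≤ b.1 i) : s a ha ≫ (P a).proj i ≫ restrict (D i).diagram hua =
        s b hb ≫ (P b).proj i ≫ restrict (D i).diagram hub := by
    have aux {a b : Node D} (ha : a < f) (hb : b < f) (hab : a ≤ b) {u : (D i).T}
        (hua : u ≤ a.1 i) (hub : u ≤ b.1 i) :
        s a ha ≫ (P a).proj i ≫ restrict (D i).diagram hua =
          s b hb ≫ (P b).proj i ≫ restrict (D i).diagram hub := by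
      rw [← hs a b ha hb hab, Category.assoc, restrict_prodDiagram_proj_assoc, restrict_trans]
    rcases Node.le_total_of_le ha.le hb.le with h | h
    · exact aux ha hb h hua hub
    · exact (aux hb ha h hub hua).symm
  have key (i : I) : ∃! z : Z ⟶ (D i).diagram.obj (op (f.1 i)), ∀ g (hg : g < f),
      z ≫ restrict (D i).diagram (hg.le i) = s g hg ≫ (P g).proj i := by
    by_cases h : ∃ g, g < f ∧ g.1 i = f.1 i
    · obtain ⟨g, hg, hgi⟩ := h
      refine ⟨s g hg ≫ (P g).proj i ≫ restrict (D i).diagram hgi.ge, fun b hb => ?_,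
        fun z hz => ?_⟩
      · simpa using compat i hg hb (hgi.symm ▸ hb.le i) le_rfl
      · rw [← reassoc_of% hz g hg]
        simp
    · push Not at h
      have hlt (g : Node D) (hg : g < f) : g.1 i < f.1 i := lt_of_le_of_ne (hg.le i) (h g hg)
      have hne : f.1 i ≠ ⊥ := fun h' => h ⊥ hbot h'.symm
      have h₁ : ∀ k < i, f.1 k ∈ (D k).leaves := fun k hk => f.mem_leaves hk hne
      -- If a later coordinate were entered, truncating `f` after `i` would give a node strictly
      -- below `f` that already attains `f.1 i`.
      have h₂ : ∀ k, i < k → f.1 k = ⊥ := fun k hk => by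
        by_contra hk'
        have hleaf := f.mem_leaves hk hk'
        let g : Node D := ⟨fun j => if j ≤ i then f.1 j else ⊥, fun {a b} hab hb => by
          by_cases hbi : b ≤ i
          · simp only [hbi, hab.le.trans hbi, ↓reduceIte] at hb ⊢
            exact f.mem_leaves hab hb
          · simp [hbi] at hb⟩
        have hg : g < f := by
          refine lt_of_le_of_ne (fun j => ?_) fun h => ?_
          · by_cases hj : j ≤ i <;> simp [g, hj]
          · have : g.1 k = f.1 k := by rw [h]
            simp only [g, hk.not_ge, ↓reduceIte] at this
            exact hk' this.symm
        exact h g hg (by simp [g])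
      have hm {u : (D i).T} (hu : u < f.1 i) : f.move i h₁ h₂ u < f :=
        lt_of_le_of_ne (Node.move_le _ _ _ _ hu.le fun _ _ => le_rfl) fun h => hu.ne (by
          conv_rhs => rw [← h]
          simp)
      have hlim : Order.IsSuccLimit (f.1 i) := by
        refine ⟨fun h => hne h.eq_bot, fun u hu => ?_⟩
        -- If `f.1 i` covered `u`, then `f` would cover the node with `i`-th coordinate `u`,
        -- contradicting that `f` is a limit.
        have hf' : (f.move i h₁ h₂ u).move i
            (fun k hk => by rw [Node.move_of_ne _ _ _ _ _ hk.ne]; exact h₁ k hk)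
            (fun k hk => by rw [Node.move_of_ne _ _ _ _ _ hk.ne']; exact h₂ k hk) (f.1 i) = f :=
          Node.ext_of_forall fun k => by
            by_cases hk : k = i
            · subst hk; simp
            · rw [Node.move_of_ne _ _ _ _ _ hk, Node.move_of_ne _ _ _ _ _ hk]
        refine hf.2 (f.move i h₁ h₂ u) ?_
        conv_rhs => rw [← hf']
        exact Node.covBy_move _ _ _ _ (by simpa using hu)
      obtain ⟨z, hz, hz'⟩ := (D i).continuous _ hlim (fun u hu => s _ (hm hu) ≫
        (P (f.move i h₁ h₂ u)).proj i ≫ restrict (D i).diagram (Node.move_self f i h₁ h₂ u).ge)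
        fun u v hu hv huv => by
          simpa using compat i (hm hv) (hm hu) (huv.trans (Node.move_self f i h₁ h₂ v).ge)
            (Node.move_self f i h₁ h₂ u).ge
      refine ⟨z, fun g hg => ?_, fun z' hz'' => hz' _ fun u hu => ?_⟩
      · rw [hz _ (hlt g hg)]
        simpa using compat i (hm (hlt g hg)) hg (Node.move_self f i h₁ h₂ _).ge le_rfl
      · rw [← reassoc_of% hz'' _ (hm hu)]
        simp
  choose z hz hz' using key
  have hbase {g : Node D} (hg : g < f) : s g hg ≫ (P g).base = s ⊥ hbot ≫ (P ⊥).base := by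
    rw [← hs ⊥ g hbot hg bot_le, Category.assoc, restrict_prodDiagram_base]
  refine ⟨(P f).lift (s ⊥ hbot ≫ (P ⊥).base) z fun i => ?_, fun g hg => ?_, fun l hl => ?_⟩
  · have : (⊥ : Node D).1 i ≤ f.1 i := bot_le
    rw [← (D i).restrict_str this, reassoc_of% hz i ⊥ hbot, (P ⊥).condition, Category.assoc]
  · refine (P g).hom_ext ?_ fun i => ?_
    · rw [Category.assoc, restrict_prodDiagram_base, FiberProduct.lift_base, hbase hg]
    · rw [Category.assoc, restrict_prodDiagram_proj, FiberProduct.lift_proj_assoc, hz]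
  · refine (P f).hom_ext ?_ fun i => ?_
    · rw [FiberProduct.lift_base, ← hl ⊥ hbot, Category.assoc, restrict_prodDiagram_base]
    · rw [FiberProduct.lift_proj]
      refine hz' i _ fun g hg => ?_
      rw [← hl g hg, Category.assoc, Category.assoc, restrict_prodDiagram_proj]

variable (D) in
/-- The lexicographic product of a family of trees with root `X`, pulled back along `g : Y ⟶ X`. -/
def prod [Fact κ.IsRegular] [Q.IsStableUnderBaseChange] [WellFoundedLT I]
    (hI : HasCardinalLT I κ) (P : ∀ f : Node D, FiberProduct g (fun i => (D i).str (f.1 i))) :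
    TreeCover Q κ Y where
  T := Node D
  le_total_of_le := Node.le_total_of_le
  hasCardinalLT_of_isChain := Node.hasCardinalLT_of_isChain hI
  bddAbove_of_isChain := Node.bddAbove_of_isChain
  diagram := prodDiagram P
  root :=
    { hom := (P ⊥).base
      inv := (P ⊥).lift (𝟙 Y) (fun i => g ≫ (D i).root.inv) fun i => by
        have : (D i).str ((⊥ : Node D).1 i) = (D i).root.hom := by
          change restrict _ (le_refl _) ≫ _ = _
          simp
        rw [this]
        simp
      hom_inv_id := (P ⊥).hom_ext (by simp) fun i => by
        have : (D i).str ((⊥ : Node D).1 i) = (D i).root.hom := by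
          change restrict _ (le_refl _) ≫ _ = _
          simp
        rw [Category.assoc, FiberProduct.lift_proj, ← (P ⊥).condition_assoc i, this]
        exact (congrArg (_ ≫ ·) (D i).root.hom_inv_id).trans
          ((Category.comp_id _).trans (Category.id_comp _).symm)
      inv_hom_id := by simp }
  leaves := {f | ∀ i, f.1 i ∈ (D i).leaves}
  isMax_of_mem_leaves f hf f' h := (Node.ext_of_forall fun i =>
    (D i).eq_of_mem_leaves (hf i) (h i)).ge
  covering f hf := prodDiagram_covering P f (by simpa using hf)
  continuous := prodDiagram_isLimitBelow P

/-- A leaf of the product is a leaf in every coordinate, so its arrow to the root, followed by `g`,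
factors through a leaf arrow of every factor. -/
lemma prod_covers [Fact κ.IsRegular] [Q.IsStableUnderBaseChange] [WellFoundedLT I]
    (hI : HasCardinalLT I κ) {S : I → Sieve X} (hS : ∀ i, (D i).Covers (S i)) {R : Sieve Y}
    (hR : ∀ ⦃Z : C⦄ (f : Z ⟶ Y), (∀ i, S i (f ≫ g)) → R f) : (prod D hI P).Covers R := by
  intro f hf
  refine hR _ fun i => ?_
  have : (prod D hI P).str f ≫ g = (P f).proj i ≫ (D i).str (f.1 i) := by
    refine Eq.trans ?_ ((P f).condition i).symm
    exact congrArg (· ≫ g) (restrict_prodDiagram_base P bot_le)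
  rw [this]
  exact (S i).downward_closed (hS i _ (hf i)) _

end Product

end TreeCover

end KappaTopos

namespace KappaTopos

variable {C : Type u} [Category.{v} C]

namespace TreeCover

variable {Q : Precoverage C} {κ : Cardinal.{w}} {X : C}

/-! ### Trees of height at most one. -/

section OneStep

/-- The vertices of a tree of height at most one. -/
inductive Star (ι : Type w) : Type w
  | root : Star ι
  | leaf (i : ι) : Star ι

namespace Star

variable {ι : Type w}

instance : PartialOrder (Star ι) where
  le a b := a = root ∨ a = b
  le_refl _ := Or.inr rfl
  le_trans := by
    rintro a _ c (rfl | rfl) h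
    · exact Or.inl rfl
    · exact h
  le_antisymm := by
    rintro a b (rfl | rfl) (h | h) <;> simp_all

instance : OrderBot (Star ι) where
  bot := root
  bot_le _ := Or.inl rfl

lemma eq_of_leaf_le {i : ι} {b : Star ι} (h : leaf i ≤ b) : leaf i = b := by
  rcases h with h | h
  · cases h
  · exact h

lemma root_covBy (i : ι) : (root : Star ι) ⋖ leaf i := by
  refine ⟨lt_of_le_of_ne bot_le (by simp), fun c h h' => ?_⟩
  cases c with
  | root => exact h.ne rfl
  | leaf j => exact h'.ne (eq_of_leaf_le h'.le)

instance : WellFoundedLT (Star ι) := by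
  refine ⟨⟨fun a => ?_⟩⟩
  have h : Acc (· < ·) (root : Star ι) := ⟨_, fun _ hb => (not_lt_bot hb).elim⟩
  refine ⟨_, fun b hb => ?_⟩
  rcases hb.le with rfl | rfl
  · exact h
  · exact (hb.ne rfl).elim

variable {Y : ι → C} (f : ∀ i, Y i ⟶ X)

/-- The values of the diagram given by a family of arrows. -/
abbrev obj (Y : ι → C) (X : C) : Star ι → C
  | root => X
  | leaf i => Y i

/-- The transition maps of the diagram given by a family of arrows. -/
def map : ∀ (a b : Star ι), a ≤ b → (obj Y X b ⟶ obj Y X a)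
  | root, root, _ => 𝟙 X
  | root, leaf i, _ => f i
  | leaf _, _, h => eqToHom (congrArg (obj Y X) (eq_of_leaf_le h).symm)

/-- The diagram given by a family of arrows. -/
abbrev diagram : (Star ι)ᵒᵖ ⥤ C where
  obj a := obj Y X a.unop
  map {a b} φ := map f b.unop a.unop (leOfHom φ.unop)
  map_id a := by
    obtain ⟨a⟩ := a
    cases a <;> rfl
  map_comp {a b c} φ ψ := by
    obtain ⟨a⟩ := a
    obtain ⟨b⟩ := b
    obtain ⟨c⟩ := c
    have h₁ : b ≤ a := leOfHom φ.unop
    have h₂ : c ≤ b := leOfHom ψ.unop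
    change map f c a _ = map f b a h₁ ≫ map f c b h₂
    rcases h₂ with rfl | rfl
    · rcases h₁ with rfl | rfl
      · exact (Category.comp_id _).symm
      · cases b
        · exact (Category.id_comp _).symm
        · exact (Category.id_comp _).symm
    · cases c
      · exact (Category.comp_id _).symm
      · exact (Category.comp_id _).symm

end Star

/-- The tree given by a family of arrows. -/
def oneStep [Fact κ.IsRegular] {ι : Type w} {Y : ι → C} (f : ∀ i, Y i ⟶ X)
    (hf : Presieve.ofArrows Y f ∈ Q X) : TreeCover Q κ X where
  T := Star ι
  le_total_of_le := by
    rintro a b t (rfl | rfl) h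
    · exact Or.inl bot_le
    · exact Or.inr h
  hasCardinalLT_of_isChain c hc := by
    have : Finite c := by
      by_cases h : ∃ i, Star.leaf i ∈ c
      · obtain ⟨i, hi⟩ := h
        refine Set.Finite.subset (Set.toFinite {Star.root, Star.leaf i}) fun a ha => ?_
        rcases hc.total ha hi with h | h
        · exact h
        · exact Or.inr (Star.eq_of_leaf_le h).symm
      · refine Set.Finite.subset (Set.toFinite {Star.root}) fun a ha => ?_
        cases a with
        | root => rfl
        | leaf i => exact (h ⟨i, ha⟩).elim
    exact hasCardinalLT_of_finite _ _ (aleph0_le_of_fact κ)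
  bddAbove_of_isChain c hc := by
    by_cases h : ∃ i, Star.leaf i ∈ c
    · obtain ⟨i, hi⟩ := h
      refine ⟨Star.leaf i, fun a ha => ?_⟩
      rcases hc.total ha hi with h | h
      · exact h
      · exact (Star.eq_of_leaf_le h).ge
    · refine ⟨Star.root, fun a ha => ?_⟩
      cases a with
      | root => exact le_rfl
      | leaf i => exact (h ⟨i, ha⟩).elim
  diagram := Star.diagram f
  root := eqToIso (by rfl)
  leaves := Set.range Star.leaf
  isMax_of_mem_leaves := by
    rintro _ ⟨i, rfl⟩ b h
    exact (Star.eq_of_leaf_le h).ge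
  covering t ht := by
    cases t with
    | leaf i => exact (ht ⟨i, rfl⟩).elim
    | root =>
      let φ : ι → {s : Star ι // Star.root ⋖ s} := fun i => ⟨_, Star.root_covBy i⟩
      have hφ : Function.Surjective φ := by
        rintro ⟨s, hs⟩
        cases s with
        | root => exact (hs.lt.ne rfl).elim
        | leaf i => exact ⟨i, rfl⟩
      rw [← Presieve.ofArrows_comp_eq_of_surjective _ hφ]
      exact hf
  continuous t ht := by
    cases t with
    | root => exact (ht.1 isMin_bot).elim
    | leaf i => exact (ht.2 _ (Star.root_covBy i)).elim

lemma oneStep_covers [Fact κ.IsRegular] {ι : Type w} {Y : ι → C} (f : ∀ i, Y i ⟶ X)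
    (hf : Presieve.ofArrows Y f ∈ Q X) {S : Sieve X} (hS : ∀ i, S (f i)) :
    (oneStep (κ := κ) f hf).Covers S := by
  rintro _ ⟨i, rfl⟩
  have : (oneStep (κ := κ) f hf).str (Star.leaf i) = f i := by
    change f i ≫ 𝟙 X = f i
    simp
  rw [this]
  exact hS i

end OneStep

/-! ### Branches of cotrees. -/

section

variable (D : ContinuousCotree Q κ)

lemma _root_.KappaTopos.ContinuousCotree.le_total_of_le {a b t : D.T} (ha : a ≤ t) (hb : b ≤ t) :
    a ≤ b ∨ b ≤ a := by
  rcases ha.eq_or_lt with rfl | ha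
  · exact Or.inr hb
  rcases hb.eq_or_lt with rfl | hb
  · exact Or.inl ha.le
  have := D.isWellOrder_Iio t
  rcases trichotomous_of (· < ·) (⟨a, ha⟩ : Set.Iio t) ⟨b, hb⟩ with h | h | h
  · exact Or.inl (le_of_lt h)
  · exact Or.inl (congrArg Subtype.val h).le
  · exact Or.inr (le_of_lt h)

instance _root_.KappaTopos.ContinuousCotree.wellFoundedLT : WellFoundedLT D.T := by
  have key (t : D.T) (s : Set.Iio t) : Acc (· < ·) s.1 := by
    have := (D.isWellOrder_Iio t).wf
    induction s using this.induction with
    | _ s ih => exact ⟨_, fun u hu => ih ⟨u, hu.trans s.2⟩ hu⟩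
  exact ⟨⟨fun t => ⟨_, fun u hu => key t ⟨u, hu⟩⟩⟩⟩

variable {D}

lemma _root_.KappaTopos.ContinuousCotree.mem_flag_of_le {b : Flag D.T} {s t : D.T} (h : s ≤ t)
    (ht : t ∈ b) : s ∈ b := by
  rw [Flag.mem_iff_forall_le_or_ge]
  intro x hx
  rcases b.le_or_le ht hx with h' | h'
  · exact Or.inl (h.trans h')
  · exact D.le_total_of_le h h'

lemma _root_.KappaTopos.ContinuousCotree.le_of_isMax {b : Flag D.T} {s t : D.T} (hs : IsMax s)
    (hs' : s ∈ b) (ht : t ∈ b) : t ≤ s := by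
  rcases b.le_or_le hs' ht with h | h
  · exact hs h
  · exact h

lemma _root_.KappaTopos.ContinuousCotree.branch_ext {b b' : D.Branch} {t : D.T} (ht : IsMax t)
    (hb : t ∈ b.1) (hb' : t ∈ b'.1) : b = b' :=
  Subtype.ext (SetLike.ext fun _ =>
    ⟨fun h => ContinuousCotree.mem_flag_of_le (ContinuousCotree.le_of_isMax ht hb h) hb',
      fun h => ContinuousCotree.mem_flag_of_le (ContinuousCotree.le_of_isMax ht hb' h) hb⟩)

lemma _root_.KappaTopos.ContinuousCotree.exists_branch {t : D.T} (ht : t ∈ D.leaves) :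
    ∃ b : D.Branch, t ∈ b.1 := by
  obtain ⟨b, hb⟩ := Flag.exists_mem t
  refine ⟨⟨b, fun s hs hs' => ?_⟩, hb⟩
  rwa [le_antisymm (ContinuousCotree.le_of_isMax (D.isMax_of_mem_leaves t ht) hb hs)
    (ContinuousCotree.le_of_isMax hs' hs hb)]

end

/-! ### Grafting trees onto the branches of a cotree. -/

section Graft

variable {D : ContinuousCotree Q κ} {c : ∀ b : D.Branch, LimitCone (D.branchDiagram b)}

/-- The vertices of the tree obtained by attaching a tree to each of the branches of `D`. -/
inductive Graft (A : ∀ b : D.Branch, TreeCover Q κ (c b).cone.pt) : Type w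
  | base (t : D.T) : Graft A
  | above (b : D.Branch) (s : (A b).T) : Graft A

namespace Graft

variable {A : ∀ b : D.Branch, TreeCover Q κ (c b).cone.pt}

/-- The order relation on `Graft A`. -/
inductive LE : Graft A → Graft A → Prop
  | base {s t : D.T} (h : s ≤ t) : LE (.base s) (.base t)
  | mem {t : D.T} {b : D.Branch} (h : t ∈ b.1) (s : (A b).T) : LE (.base t) (.above b s)
  | above {b : D.Branch} {s t : (A b).T} (h : s ≤ t) : LE (.above b s) (.above b t)

instance : PartialOrder (Graft A) where
  le := LE
  le_refl a := by
    cases a with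
    | base t => exact .base le_rfl
    | above b s => exact .above le_rfl
  le_trans a b c h h' := by
    cases h with
    | base h =>
      cases h' with
      | base h' => exact .base (h.trans h')
      | mem h' s => exact .mem (ContinuousCotree.mem_flag_of_le h h') s
    | mem h s =>
      cases h' with
      | above h' => exact .mem h _
    | above h =>
      cases h' with
      | above h' => exact .above (h.trans h')
  le_antisymm a b h h' := by
    cases h with
    | base h =>
      cases h' with
      | base h' => rw [le_antisymm h h']
    | mem h s => cases h'
    | above h =>
      cases h' with
      | above h' => rw [le_antisymm h h']

lemma base_le_base {s t : D.T} : (base s : Graft A) ≤ base t ↔ s ≤ t :=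
  ⟨fun h => by cases h; assumption, .base⟩

lemma base_le_above {t : D.T} {b : D.Branch} {s : (A b).T} :
    (base t : Graft A) ≤ above b s ↔ t ∈ b.1 :=
  ⟨fun h => by cases h; assumption, fun h => .mem h s⟩

lemma above_le_above {b : D.Branch} {s t : (A b).T} :
    (above b s : Graft A) ≤ above b t ↔ s ≤ t :=
  ⟨fun h => by cases h; assumption, .above⟩

lemma base_lt_base {s t : D.T} : (base s : Graft A) < base t ↔ s < t := by
  simp [lt_iff_le_not_ge, base_le_base]

lemma above_lt_above {b : D.Branch} {s t : (A b).T} :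
    (above b s : Graft A) < above b t ↔ s < t := by
  simp [lt_iff_le_not_ge, above_le_above]

lemma base_lt_above {t : D.T} {b : D.Branch} {s : (A b).T} (h : t ∈ b.1) :
    (base t : Graft A) < above b s :=
  lt_of_le_of_ne (base_le_above.2 h) (by simp)

lemma exists_of_above_le {b : D.Branch} {s : (A b).T} {x : Graft A} (h : above b s ≤ x) :
    ∃ t, x = above b t ∧ s ≤ t := by
  cases h with
  | above h => exact ⟨_, rfl, h⟩

instance : OrderBot (Graft A) where
  bot := base ⊥
  bot_le a := by
    cases a with
    | base t => exact .base bot_le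
    | above b s => exact .mem b.1.bot_mem s

instance : WellFoundedLT (Graft A) := by
  have h₁ (t : D.T) : Acc (· < ·) (base t : Graft A) := by
    induction t using WellFoundedLT.induction with
    | _ t ih =>
      refine ⟨_, fun x hx => ?_⟩
      cases x with
      | base s => exact ih s (base_lt_base.1 hx)
      | above b s => cases hx.le
  have h₂ (b : D.Branch) (s : (A b).T) : Acc (· < ·) (above b s : Graft A) := by
    induction s using WellFoundedLT.induction with
    | _ s ih =>
      refine ⟨_, fun x hx => ?_⟩
      cases x with
      | base s => exact h₁ s
      | above b' s' =>
        obtain ⟨_, h, h'⟩ := exists_of_above_le hx.le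
        cases h
        exact ih _ (above_lt_above.1 hx)
  refine ⟨⟨fun a => ?_⟩⟩
  cases a with
  | base t => exact h₁ t
  | above b s => exact h₂ b s

lemma le_total_of_le {x y z : Graft A} (h : x ≤ z) (h' : y ≤ z) : x ≤ y ∨ y ≤ x := by
  cases h with
  | base h =>
    cases h' with
    | base h' => simpa only [base_le_base] using D.le_total_of_le h h'
  | mem h s =>
    cases h' with
    | mem h' => simpa only [base_le_base] using Flag.le_or_le _ h h'
    | above h' => exact Or.inl (.mem h _)
  | above h =>
    cases h' with
    | mem h' => exact Or.inr (.mem h' _)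
    | above h' => simpa only [above_le_above] using (A _).le_total_of_le h h'

lemma isChain_base {s : Set (Graft A)} (hs : IsChain (· ≤ ·) s) :
    IsChain (· ≤ ·) {t : D.T | base t ∈ s} := fun a ha b hb _ => by
  simpa only [base_le_base] using hs.total ha hb

lemma isChain_above {s : Set (Graft A)} (hs : IsChain (· ≤ ·) s) (b : D.Branch) :
    IsChain (· ≤ ·) {t : (A b).T | above b t ∈ s} := fun x hx y hy _ => by
  simpa only [above_le_above] using hs.total hx hy

lemma bddAbove_of_isChain (s : Set (Graft A)) (hs : IsChain (· ≤ ·) s) : BddAbove s := by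
  by_cases h : ∃ b t, above b t ∈ s
  · obtain ⟨b, t, ht⟩ := h
    obtain ⟨u, hu⟩ := (A b).bddAbove_of_isChain _ (isChain_above hs b)
    refine ⟨above b u, fun x hx => ?_⟩
    have hut : above b t ≤ above b u := .above (hu ht)
    rcases hs.total hx ht with h | h
    · exact h.trans hut
    · obtain ⟨v, rfl, -⟩ := exists_of_above_le h
      exact .above (hu hx)
  -- Extend the chain to a maximal one. It is bounded by the root of the tree grafted there or, if
  -- it ends at a vertex covered by the empty family, by that vertex.
  · obtain ⟨b, hb⟩ := (isChain_base hs).exists_subset_flag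
    have hb' {x : Graft A} (hx : x ∈ s) : ∃ t ∈ b, x = base t := by
      cases x with
      | base t => exact ⟨t, hb hx, rfl⟩
      | above b t => exact (h ⟨b, t, hx⟩).elim
    by_cases hbl : ∀ t ∈ b, IsMax t → t ∈ D.leaves
    · refine ⟨above ⟨b, hbl⟩ ⊥, fun x hx => ?_⟩
      obtain ⟨t, ht, rfl⟩ := hb' hx
      exact .mem ht _
    · push Not at hbl
      obtain ⟨u, hu, hu', -⟩ := hbl
      refine ⟨base u, fun x hx => ?_⟩
      obtain ⟨t, ht, rfl⟩ := hb' hx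
      exact .base (ContinuousCotree.le_of_isMax hu' hu ht)

lemma hasCardinalLT_of_isChain [Fact κ.IsRegular] (s : Set (Graft A)) (hs : IsChain (· ≤ ·) s) :
    HasCardinalLT s κ := by
  have h₁ : HasCardinalLT (base '' {t : D.T | (base t : Graft A) ∈ s} : Set (Graft A)) κ := by
    obtain ⟨b, hb⟩ := (isChain_base hs).exists_subset_flag
    exact ((D.hasCardinalLT_branch b).of_injective _ (Set.inclusion_injective hb)).of_surjective _
      Set.imageFactorization_surjective
  by_cases h : ∃ b t, above b t ∈ s
  · obtain ⟨b, t, ht⟩ := h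
    have h₂ : HasCardinalLT (above b '' {t : (A b).T | above b t ∈ s} : Set (Graft A)) κ :=
      ((A b).hasCardinalLT_of_isChain _ (isChain_above hs b)).of_surjective _
        Set.imageFactorization_surjective
    refine (hasCardinalLT_union (aleph0_le_of_fact κ) h₁ h₂).of_injective _
      (Set.inclusion_injective fun x hx => ?_)
    cases x with
    | base t => exact Or.inl ⟨t, hx, rfl⟩
    | above b' t' =>
      refine Or.inr ?_
      rcases hs.total hx ht with h | h
      · obtain ⟨_, h, -⟩ := exists_of_above_le h
        cases h
        exact ⟨_, hx, rfl⟩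
      · obtain ⟨_, h, -⟩ := exists_of_above_le h
        cases h
        exact ⟨_, hx, rfl⟩
  · refine h₁.of_injective _ (Set.inclusion_injective fun x hx => ?_)
    cases x with
    | base t => exact ⟨t, hx, rfl⟩
    | above b t => exact (h ⟨b, t, hx⟩).elim

/-- The objects at the vertices of the grafted tree. -/
abbrev obj : Graft A → C
  | base t => D.diagram.obj (op t)
  | above b s => (A b).diagram.obj (op s)

lemma branch_eq_of_le {b b' : D.Branch} {s : (A b).T} {s' : (A b').T}
    (h : above b s ≤ above b' s') : b = b' := by
  cases h
  rfl

lemma le_of_le {b b' : D.Branch} {s : (A b).T} {s' : (A b').T}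
    (h : above b s ≤ above b' s') : branch_eq_of_le h ▸ s ≤ s' := by
  cases h
  assumption

/-- The transition maps of the grafted tree. -/
def map : ∀ (x y : Graft A), x ≤ y → (obj y ⟶ obj x)
  | base s, base t, h => restrict D.diagram (base_le_base.1 h)
  | base t, above b s, h => (A b).str s ≫ (c b).cone.π.app (op ⟨t, base_le_above.1 h⟩)
  | above b s, above b' s', h => by
    have hb := branch_eq_of_le h
    have hs := le_of_le h
    subst hb
    exact restrict (A b).diagram hs
  | above _ _, base _, h => (show False by cases h).elim

lemma map_trans {x y z : Graft A} (h : x ≤ y) (h' : y ≤ z) :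
    map y z h' ≫ map x y h = map x z (h.trans h') := by
  cases h with
  | base h =>
    cases h' with
    | base h' => exact restrict_trans _ h h'
    | @mem _ b h' s =>
      have := (c b).cone.w (j := op ⟨_, h'⟩)
        (j' := op ⟨_, ContinuousCotree.mem_flag_of_le h h'⟩) (homOfLE h).op
      exact (Category.assoc _ _ _).trans (congrArg ((A b).str s ≫ ·) this)
  | @mem t b h s =>
    cases h' with
    | above h' => exact restrict_str_assoc (A b) h' _
  | above h =>
    cases h' with
    | above h' => exact restrict_trans _ h h'

/-- The diagram of the grafted tree. -/
abbrev diagram : (Graft A)ᵒᵖ ⥤ C where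
  obj x := obj x.unop
  map {x y} φ := map y.unop x.unop (leOfHom φ.unop)
  map_id x := by
    obtain ⟨x⟩ := x
    cases x with
    | base t => exact restrict_refl _ t
    | above b s => exact restrict_refl _ s
  map_comp {x y z} φ ψ := (map_trans (leOfHom ψ.unop) (leOfHom φ.unop)).symm

lemma base_covBy_base {s t : D.T} (h : s ⋖ t) : (base s : Graft A) ⋖ base t := by
  refine ⟨base_lt_base.2 h.lt, fun x hx hx' => ?_⟩
  cases x with
  | base u => exact h.2 (base_lt_base.1 hx) (base_lt_base.1 hx')
  | above b u => cases hx'.le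

lemma above_covBy_above {b : D.Branch} {s t : (A b).T} (h : s ⋖ t) :
    (above b s : Graft A) ⋖ above b t := by
  refine ⟨above_lt_above.2 h.lt, fun x hx hx' => ?_⟩
  obtain ⟨u, rfl, -⟩ := exists_of_above_le hx.le
  exact h.2 (above_lt_above.1 hx) (above_lt_above.1 hx')

instance isIso_str_bot {Y : C} (B : TreeCover Q κ Y) : IsIso (B.str ⊥) := by
  have : B.str ⊥ = B.root.hom := by simp [str]
  rw [this]
  infer_instance

lemma map_above_bot {t : D.T} {b : D.Branch} (h : t ∈ b.1) (s : (A b).T) :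
    map (above b ⊥) (above b s) (.above bot_le : (above b ⊥ : Graft A) ≤ above b s) ≫
      map (base t) (above b ⊥) (.mem h ⊥ : (base t : Graft A) ≤ above b ⊥) =
      map (base t) (above b s) (.mem h s : (base t : Graft A) ≤ above b s) :=
  map_trans _ _

lemma isIso_cone_π (b : D.Branch) {t : D.T} (ht : t ∈ b.1) (ht' : IsMax t) :
    IsIso ((c b).cone.π.app (op ⟨t, ht⟩)) := by
  let h : IsTerminal (⟨t, ht⟩ : (b.1 : Set D.T)) :=
    IsTerminal.ofUniqueHom
      (fun x => homOfLE (show x.1 ≤ t from ContinuousCotree.le_of_isMax ht' ht x.2))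
      fun _ _ => Subsingleton.elim _ _
  exact IsLimit.isIso_π_app_of_isInitial (c b).isLimit _ (initialOpOfTerminal h)

/-- Covers inside a grafted tree or over a non-leaf of `D` are the old ones. Over a leaf of `D` the
only cover is the root of the grafted tree, and the arrow is invertible because the limit along a
branch with a last vertex is the value there; hence the need for isomorphisms in `Q`. -/
lemma covering [Q.HasIsos] (x : Graft A) (hx : ∀ b, ∀ s ∈ (A b).leaves, x ≠ above b s) :
    Presieve.ofArrows (fun y : {y : Graft A // x ⋖ y} => obj y.1)
      (fun y => map x y.1 y.2.le) ∈ Q (obj x) := by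
  cases x with
  | above b s =>
    let φ : {t : (A b).T // s ⋖ t} → {y : Graft A // above b s ⋖ y} := fun t =>
      ⟨_, above_covBy_above t.2⟩
    have hφ : Function.Surjective φ := by
      rintro ⟨y, hy⟩
      obtain ⟨t, rfl, -⟩ := exists_of_above_le hy.le
      exact ⟨⟨t, above_lt_above.1 hy.lt, fun u hu hu' =>
        hy.2 (above_lt_above.2 hu) (above_lt_above.2 hu')⟩, rfl⟩
    rw [← Presieve.ofArrows_comp_eq_of_surjective _ hφ]
    exact (A b).covering s fun hs => hx b s hs rfl
  | base t =>
    by_cases ht : t ∈ D.leaves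
    · obtain ⟨b, hb⟩ := ContinuousCotree.exists_branch ht
      have ht' := D.isMax_of_mem_leaves t ht
      have hcov : (base t : Graft A) ⋖ above b ⊥ := by
        refine ⟨base_lt_above hb, fun x hx hx' => ?_⟩
        cases x with
        | base s => exact ht'.not_lt (base_lt_base.1 hx)
        | above b' s =>
          obtain ⟨u, hu, -⟩ := exists_of_above_le hx'.le
          cases hu
          exact not_lt_bot (above_lt_above.1 hx')
      let φ : PUnit.{w + 1} → {y : Graft A // base t ⋖ y} := fun _ => ⟨_, hcov⟩
      have hφ : Function.Surjective φ := by
        rintro ⟨y, hy⟩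
        refine ⟨PUnit.unit, Subtype.ext ?_⟩
        cases y with
        | base s => exact (ht'.not_lt (base_lt_base.1 hy.lt)).elim
        | above b' s =>
          have hb' := base_le_above.1 hy.le
          obtain rfl := ContinuousCotree.branch_ext ht' hb hb'
          by_contra hne
          exact hy.2 (base_lt_above hb') (lt_of_le_of_ne (.above bot_le) hne)
      rw [← Presieve.ofArrows_comp_eq_of_surjective _ hφ]
      have := isIso_cone_π (c := c) b hb ht'
      have : IsIso (map (base t) (above b ⊥) hcov.le) :=
        inferInstanceAs (IsIso ((A b).str ⊥ ≫ (c b).cone.π.app (op ⟨t, hb⟩)))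
      have key := Q.mem_coverings_of_isIso (map (base t) (above b ⊥) hcov.le)
      rwa [← Presieve.ofArrows_pUnit] at key
    · let φ : {s : D.T // t ⋖ s} → {y : Graft A // base t ⋖ y} := fun s =>
        ⟨_, base_covBy_base s.2⟩
      have hφ : Function.Surjective φ := by
        rintro ⟨y, hy⟩
        cases y with
        | base s =>
          exact ⟨⟨s, base_lt_base.1 hy.lt, fun u hu hu' =>
            hy.2 (base_lt_base.2 hu) (base_lt_base.2 hu')⟩, rfl⟩
        | above b s =>
          -- A grafted vertex cannot cover a non-leaf `t`: then `t` would be the last vertex of `b`,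
          -- hence maximal in the tree, and a contributing branch ends only at leaves.
          have hb := base_le_above.1 hy.le
          have hb' {u : D.T} (hu : u ∈ b.1) : ¬ t < u := fun htu =>
            hy.2 (base_lt_base.2 htu) (base_lt_above hu)
          refine (ht (b.2 t hb fun u hu => ?_)).elim
          by_contra hut
          refine hb' (Flag.mem_iff_forall_le_or_ge.2 fun x hx => Or.inr ?_) (lt_of_le_not_ge hu hut)
          rcases b.1.le_or_le hb hx with h | h
          · exact (eq_of_le_of_not_lt h (hb' hx)).ge.trans hu
          · exact h.trans hu
      rw [← Presieve.ofArrows_comp_eq_of_surjective _ hφ]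
      exact D.covering t ht

/-- The root of a grafted tree carries the limit along its branch, which is the limit of everything
below it. For the other grafted vertices, the legs to base vertices factor through that root, so
only the part inside the grafted tree matters. -/
lemma isLimitBelow_diagram (x : Graft A) (hx : Order.IsSuccLimit x) :
    IsLimitBelow (diagram (A := A)) x := by
  cases x with
  | base t =>
    have ht : Order.IsSuccLimit t := by
      refine ⟨fun h => hx.1 fun y hy => ?_, fun u hu => hx.2 _ (base_covBy_base hu)⟩
      cases y with
      | base u => exact .base (h (base_le_base.1 hy))
      | above b u => cases hy
    intro Z s hs
    obtain ⟨z, hz, hz'⟩ := (isLimitBelow_iff _ _).2 (D.continuous t ht)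
      (fun u hu => s (base u) (base_lt_base.2 hu)) fun u v hu hv huv =>
        hs (base u) (base v) _ _ (.base huv)
    refine ⟨z, fun y hy => ?_, fun z' h => hz' z' fun u hu => h _ (base_lt_base.2 hu)⟩
    cases y with
    | base u => exact hz u (base_lt_base.1 hy)
    | above b u => cases hy.le
  | above b t =>
    intro Z s hs
    by_cases ht : t = ⊥
    · subst ht
      let σ : Cone (D.branchDiagram b) :=
        { pt := Z
          π :=
            { app := fun u => s (base u.unop.1) (base_lt_above u.unop.2)
              naturality := fun u v f => (Category.id_comp _).trans
                (hs (base v.unop.1) (base u.unop.1) _ _ (.base (leOfHom f.unop))).symm } }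
      refine ⟨(c b).isLimit.lift σ ≫ inv ((A b).str ⊥), fun y hy => ?_, fun z hz => ?_⟩
      · cases y with
        | base u =>
          have : (c b).isLimit.lift σ ≫ (c b).cone.π.app (op ⟨u, base_le_above.1 hy.le⟩) =
            s (base u) hy := (c b).isLimit.fac σ _
          exact (Category.assoc _ _ _).trans
            ((congrArg (_ ≫ ·) (IsIso.inv_hom_id_assoc _ _)).trans this)
        | above b' u =>
          obtain ⟨u', hu, -⟩ := exists_of_above_le hy.le
          cases hu
          exact (not_lt_bot (above_lt_above.1 hy)).elim
      · rw [IsIso.eq_comp_inv]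
        refine (c b).isLimit.hom_ext fun u => ?_
        rw [(c b).isLimit.fac, Category.assoc]
        exact hz (base u.unop.1) (base_lt_above u.unop.2)
    · have hbt : (above b ⊥ : Graft A) < above b t := above_lt_above.2 (bot_lt_iff_ne_bot.2 ht)
      have ht' : Order.IsSuccLimit t :=
        ⟨fun h => ht h.eq_bot, fun u hu => hx.2 _ (above_covBy_above hu)⟩
      obtain ⟨z, hz, hz'⟩ := (A b).continuous t ht'
        (fun u hu => s (above b u) (above_lt_above.2 hu)) fun u v hu hv huv =>
          hs (above b u) (above b v) _ _ (.above huv)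
      refine ⟨z, fun y hy => ?_, fun z' h => hz' z' fun u hu => h _ (above_lt_above.2 hu)⟩
      cases y with
      | base u =>
        have hu := base_le_above.1 hy.le
        have h₁ := hs (base u) (above b ⊥) hy hbt (.mem hu ⊥)
        rw [← h₁, ← hz ⊥ (bot_lt_iff_ne_bot.2 ht), Category.assoc]
        exact congrArg (z ≫ ·) (map_above_bot hu t).symm
      | above b' u =>
        obtain ⟨u', hu, -⟩ := exists_of_above_le hy.le
        cases hu
        exact hz u (above_lt_above.1 hy)

end Graft

/-- The tree obtained by attaching a tree to each of the branches of a cotree. -/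
def graft [Fact κ.IsRegular] [Q.HasIsos] (A : ∀ b : D.Branch, TreeCover Q κ (c b).cone.pt) :
    TreeCover Q κ (D.diagram.obj (op ⊥)) where
  T := Graft A
  le_total_of_le := Graft.le_total_of_le
  hasCardinalLT_of_isChain := Graft.hasCardinalLT_of_isChain
  bddAbove_of_isChain := Graft.bddAbove_of_isChain
  diagram := Graft.diagram
  root := eqToIso (by rfl)
  leaves := {x | ∃ b, ∃ s ∈ (A b).leaves, x = .above b s}
  isMax_of_mem_leaves := by
    rintro _ ⟨b, s, hs, rfl⟩ y hy
    obtain ⟨t, rfl, ht⟩ := Graft.exists_of_above_le hy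
    exact .above ((A b).isMax_of_mem_leaves s hs ht)
  covering x hx := Graft.covering x fun b s hs h => hx ⟨b, s, hs, h⟩
  continuous := Graft.isLimitBelow_diagram

lemma graft_covers [Fact κ.IsRegular] [Q.HasIsos]
    (A : ∀ b : D.Branch, TreeCover Q κ (c b).cone.pt) {R : Sieve (D.diagram.obj (op ⊥))}
    (hR : ∀ b, (A b).Covers (R.pullback ((c b).cone.π.app (op b.root)))) :
    (graft A).Covers R := by
  rintro _ ⟨b, s, hs, rfl⟩
  have : (graft A).str (.above b s) = (A b).str s ≫ (c b).cone.π.app (op b.root) := by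
    change (_ ≫ _) ≫ 𝟙 _ = _
    simp
    rfl
  rw [this]
  exact hR b s hs

end Graft

end TreeCover

end KappaTopos

/-! ### The Grothendieck topology of tree covers. -/

namespace KappaTopos

variable {C : Type u} [Category.{v} C] {Q : Precoverage C} {κ : Cardinal.{w}} {X Y : C}

namespace TreeCover

/-- Replacing the root of a tree by an isomorphic object. -/
def ofIso (D : TreeCover Q κ X) (e : X ≅ Y) : TreeCover Q κ Y :=
  { D with root := D.root ≪≫ e }

lemma ofIso_covers (D : TreeCover Q κ X) (e : X ≅ Y) {S : Sieve Y}
    (h : D.Covers (S.pullback e.hom)) : (D.ofIso e).Covers S := by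
  intro t ht
  have : (D.ofIso e).str t = D.str t ≫ e.hom := (Category.assoc _ _ _).symm
  rw [this]
  exact h t ht

/-- The cotree underlying a tree cover. -/
def toCotree (D : TreeCover Q κ X) : ContinuousCotree Q κ where
  T := D.T
  isWellOrder_Iio t :=
    { trichotomous := fun a b h₁ h₂ => by
        rcases D.le_total_of_le (le_of_lt a.2) (le_of_lt b.2) with h | h
        · exact eq_of_le_of_not_lt h h₁
        · exact Subtype.ext (eq_of_le_of_not_lt h h₂).symm }
  diagram := D.diagram
  leaves := D.leaves
  isMax_of_mem_leaves := D.isMax_of_mem_leaves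
  covering := D.covering
  hasCardinalLT_branch b := D.hasCardinalLT_of_isChain _ b.Chain'
  continuous t ht := (isLimitBelow_iff _ _).1 (D.continuous t ht)

/-- An upper bound of a maximal chain belongs to it and is maximal in the tree, so a contributing
branch must end there at a leaf. -/
lemma exists_mem_leaves (D : TreeCover Q κ X) (b : D.toCotree.Branch) :
    ∃ t ∈ b.1, t ∈ D.leaves := by
  obtain ⟨u, hu⟩ := D.bddAbove_of_isChain _ b.1.Chain'
  have hub : u ∈ b.1 := Flag.mem_iff_forall_le_or_ge.2 fun x hx => Or.inr (hu hx)
  refine ⟨u, hub, b.2 u hub fun v hv => hu ?_⟩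
  exact Flag.mem_iff_forall_le_or_ge.2 fun x hx => Or.inr ((hu hx).trans hv)

lemma exists_limitCone [Fact κ.IsRegular] [IsLexCategory κ C] (D : ContinuousCotree Q κ)
    (b : D.Branch) : Nonempty (LimitCone (D.branchDiagram b)) := by
  have : HasLimitsOfShape ((b.1 : Set D.T)ᵒᵖ) C :=
    IsLexCategory.hasLimitsOfShape (κ := κ) _ (hasCardinalLT_arrow_of_isThin κ _
      ((D.hasCardinalLT_branch b.1).of_injective unop unop_injective))
  exact ⟨getLimitCone _⟩

lemma Covers.cone_π {D : TreeCover Q κ X} {S : Sieve X} (h : D.Covers S) (b : D.toCotree.Branch)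
    (c : Cone (D.toCotree.branchDiagram b)) :
    S.pullback D.root.hom (c.π.app (op b.root)) := by
  obtain ⟨t, htb, ht⟩ := D.exists_mem_leaves b
  have h₁ := c.w (j := op ⟨t, htb⟩) (j' := op b.root)
    (homOfLE (show (⊥ : D.T) ≤ t from bot_le)).op
  have h₂ := S.downward_closed (h t ht) (c.π.app (op ⟨t, htb⟩))
  have h₃ : c.π.app (op b.root) ≫ D.root.hom = c.π.app (op ⟨t, htb⟩) ≫ D.str t := by
    refine Eq.trans (congrArg (· ≫ D.root.hom) h₁.symm) ?_
    exact Category.assoc _ _ _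
  change S (c.π.app (op b.root) ≫ D.root.hom)
  rw [h₃]
  exact h₂

/-- The tree which consists of a single arrow `𝟙 X`. -/
def trivial [Fact κ.IsRegular] [Q.HasIsos] (X : C) : TreeCover Q κ X :=
  oneStep (ι := PUnit) (Y := fun _ => X) (fun _ => 𝟙 X) (by
    rw [Presieve.ofArrows_pUnit]
    exact Q.mem_coverings_of_isIso (𝟙 X))

lemma trivial_covers [Fact κ.IsRegular] [Q.HasIsos] (X : C) :
    (trivial (Q := Q) (κ := κ) X).Covers ⊤ :=
  oneStep_covers _ _ fun _ => ⟨⟩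

end TreeCover

variable (Q κ) in
/-- The Grothendieck topology whose covering sieves are those which are covered by a tree. -/
def treeTopology [Fact κ.IsRegular] [IsLexCategory κ C] [Q.IsStableUnderBaseChange] [Q.HasIsos] :
    GrothendieckTopology C where
  sieves X := {S | ∃ D : TreeCover Q κ X, D.Covers S}
  top_mem' X := ⟨_, TreeCover.trivial_covers X⟩
  pullback_stable' X Y S f := by
    rintro ⟨D, hD⟩
    -- A product with a single factor is the pullback of the tree along `f`.
    have hI : HasCardinalLT PUnit.{w + 1} κ := hasCardinalLT_of_finite _ _ (aleph0_le_of_fact κ)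
    let P (g : TreeCover.Node fun _ : PUnit.{w + 1} => D) :=
      (nonempty_fiberProduct κ f hI fun i => D.str (g.1 i)).some
    exact ⟨TreeCover.prod _ hI P, TreeCover.prod_covers P hI (fun _ => hD)
      fun Z g h => h PUnit.unit⟩
  transitive' X S := by
    rintro ⟨D, hD⟩ R hR
    -- Grafting takes place at branch limits instead of leaves, so that the same construction also
    -- serves arbitrary cotrees.
    let c (b : D.toCotree.Branch) := (TreeCover.exists_limitCone D.toCotree b).some
    choose A hA using fun b => hR (hD.cone_π b (c b).cone)
    refine ⟨(TreeCover.graft (c := c) A).ofIso D.root, TreeCover.ofIso_covers _ _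
      (TreeCover.graft_covers A fun b => ?_)⟩
    exact (Sieve.pullback_comp R) ▸ hA b

section

variable [Fact κ.IsRegular] [IsLexCategory κ C] [Q.IsStableUnderBaseChange] [Q.HasIsos]

lemma generate_mem_treeTopology {ι : Type w} {Y : ι → C} {f : ∀ i, Y i ⟶ X}
    (hf : Presieve.ofArrows Y f ∈ Q X) :
    Sieve.generate (Presieve.ofArrows Y f) ∈ treeTopology Q κ X :=
  ⟨_, TreeCover.oneStep_covers f hf fun i => Sieve.le_generate _ _ _ (Presieve.ofArrows.mk i)⟩

/-- Grafting the identity tree onto every contributing branch adds the branch limits as vertices,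
turning a cotree with possibly unbounded branches into a tree cover. -/
lemma generate_mem_treeTopology_of_isTreeFamily {R : Presieve X} (hR : IsTreeFamily Q κ R) :
    Sieve.generate R ∈ treeTopology Q κ X := by
  obtain ⟨D, c⟩ := hR
  refine ⟨_, TreeCover.graft_covers (c := c) (fun b => TreeCover.trivial _) fun b => ?_⟩
  have h := Sieve.pullback_eq_top_of_mem _
    (Sieve.le_generate _ _ _ (Presieve.ofArrows.mk (X := D.diagram.obj (op ⊥))
      (Y := fun b : D.Branch => (c b).cone.pt) (f := fun b => (c b).cone.π.app (op b.root)) b))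
  exact h ▸ TreeCover.trivial_covers _

lemma exists_isTreeFamily_of_mem_treeTopology {S : Sieve X} (hS : S ∈ treeTopology Q κ X) :
    ∃ (X' : C) (e : X' ≅ X) (R : Presieve X'), IsTreeFamily Q κ R ∧
      R ≤ (S.pullback e.hom).arrows := by
  obtain ⟨D, hD⟩ := hS
  refine ⟨_, D.root, _, ⟨D.toCotree, fun b => (TreeCover.exists_limitCone D.toCotree b).some⟩, ?_⟩
  exact Presieve.ofArrows_le_iff.2 fun b => hD.cone_π b _

lemma toGrothendieck_treeClosure : (treeClosure κ Q).toGrothendieck = treeTopology Q κ := by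
  refine le_antisymm ?_ fun X S hS => ?_
  · rw [Precoverage.toGrothendieck_le_iff_le_toPrecoverage]
    exact fun X R hR => generate_mem_treeTopology_of_isTreeFamily hR
  · obtain ⟨X', e, R, hR, hRS⟩ := exists_isTreeFamily_of_mem_treeTopology hS
    have h : S.pullback e.hom ∈ (treeClosure κ Q).toGrothendieck X' :=
      GrothendieckTopology.superset_covering _ ((Sieve.generate_le_iff _ _).2 hRS)
        (Precoverage.generate_mem_toGrothendieck hR)
    have h' := GrothendieckTopology.pullback_stable _ e.inv h
    rwa [← Sieve.pullback_comp, e.inv_hom_id, Sieve.pullback_id] at h'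

/-- The lexicographic product along any well-order of `I` refines all the given trees at once. -/
lemma iInf_mem_treeTopology {I : Type w} (hI : HasCardinalLT I κ) {S : I → Sieve X}
    (hS : ∀ i, S i ∈ treeTopology Q κ X) : ⨅ i, S i ∈ treeTopology Q κ X := by
  choose D hD using hS
  obtain ⟨_, _⟩ := exists_wellFoundedLT I
  let P (g : TreeCover.Node D) :=
    (nonempty_fiberProduct κ (𝟙 X) hI fun i => (D i).str (g.1 i)).some
  refine ⟨TreeCover.prod _ hI P, TreeCover.prod_covers P hI hD fun Z g h => ?_⟩
  rintro _ ⟨i, rfl⟩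
  simpa using h i

end

end KappaTopos

namespace KappaTopos

/-! ### `κ`-lexness from finite limits and products. -/

section Lex

variable (κ : Cardinal.{w}) [Fact κ.IsRegular]

lemma hasCardinalLT_arrow_ulift (J : Type) [SmallCategory J] [FinCategory J] :
    HasCardinalLT (Arrow (ULiftHom.{w} (ULift.{w} J))) κ :=
  HasCardinalLT.of_le (κ := Cardinal.aleph0.{w})
    ((hasCardinalLT_aleph0_iff _).2 Arrow.finite) (aleph0_le_of_fact κ)

lemma IsLexCategory.hasFiniteLimits (C : Type u) [Category.{v} C] [IsLexCategory κ C] :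
    HasFiniteLimits C where
  out J _ _ := by
    have := IsLexCategory.hasLimitsOfShape (κ := κ) (C := C) _ (hasCardinalLT_arrow_ulift κ J)
    exact hasLimitsOfShape_of_equivalence (ULiftHomULiftCategory.equiv.{w, w} J).symm

variable {κ}

lemma IsLexFunctor.preservesFiniteLimits {C D : Type*} [Category* C] [Category* D] {F : C ⥤ D}
    (hF : IsLexFunctor κ F) : PreservesFiniteLimits F where
  preservesFiniteLimits J _ _ := by
    obtain ⟨_⟩ := hF _ (hasCardinalLT_arrow_ulift κ J)
    exact preservesLimitsOfShape_of_equiv (ULiftHomULiftCategory.equiv.{w, w} J).symm F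

lemma hasCardinalLT_arrow_discrete {I : Type w} (hI : HasCardinalLT I κ) :
    HasCardinalLT (Arrow (Discrete I)) κ :=
  hasCardinalLT_arrow_of_isThin κ _ (hI.of_injective _ (discreteEquiv (α := I)).injective)

lemma isLexFunctor_of_preservesProducts {C D : Type*} [Category* C] [Category* D] {F : C ⥤ D}
    [IsLexCategory κ C] [PreservesFiniteLimits F]
    (h : ∀ I : Type w, HasCardinalLT I κ → PreservesLimitsOfShape (Discrete I) F) :
    IsLexFunctor κ F := fun J _ hJ => by
  have hJ' : HasCardinalLT J κ := hJ.of_injective (fun j => Arrow.mk (𝟙 j)) fun i j hij =>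
    congrArg Arrow.leftFunc.obj hij
  have hA : HasCardinalLT (Σ p : J × J, p.1 ⟶ p.2) κ :=
    hJ.of_injective (fun f => Arrow.mk f.2) (by
      rintro ⟨⟨X, Y⟩, f⟩ ⟨⟨X', Y'⟩, f'⟩ h
      obtain ⟨rfl, rfl⟩ : X = X' ∧ Y = Y' :=
        ⟨congrArg Arrow.leftFunc.obj h, congrArg Arrow.rightFunc.obj h⟩
      obtain rfl : f = f' := (Arrow.mk_injective X Y) h
      rfl)
  have := IsLexCategory.hasLimitsOfShape (κ := κ) (C := C) _ (hasCardinalLT_arrow_discrete hJ')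
  have := IsLexCategory.hasLimitsOfShape (κ := κ) (C := C) _ (hasCardinalLT_arrow_discrete hA)
  have := IsLexCategory.hasFiniteLimits κ C
  have := h _ hJ'
  have := h _ hA
  exact ⟨preservesLimit_of_preservesEqualizers_and_product F⟩

end Lex

/-! ### Extremal epimorphic families and the topology of their trees. -/

section Extremal

variable {E : Type u} [Category.{v} E]

lemma IsExtremalEpic.hom_ext [HasEqualizers E] {X Y : E} {R : Presieve X} (hR : IsExtremalEpic R)
    {f g : X ⟶ Y} (h : ∀ ⦃Z : E⦄ ⦃r : Z ⟶ X⦄, R r → r ≫ f = r ≫ g) : f = g := by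
  have := hR (equalizer.ι f g) fun Z r hr => ⟨equalizer.lift r (h hr), equalizer.lift_ι _ _⟩
  exact eq_of_epi_equalizer

lemma IsExtremalEpic.of_iso {X X' : E} (e : X' ≅ X) {R : Presieve X'} (hR : IsExtremalEpic R)
    {S : Presieve X} (h : ∀ ⦃Z : E⦄ ⦃r : Z ⟶ X'⦄, R r →
      ∃ (W : E) (a : Z ⟶ W) (s : W ⟶ X), S s ∧ a ≫ s = r ≫ e.hom) :
    IsExtremalEpic S := fun U m _ hm => by
  have : IsIso (m ≫ e.inv) := hR _ fun Z r hr => by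
    obtain ⟨W, a, s, hs, h'⟩ := h hr
    obtain ⟨b, rfl⟩ := hm hs
    exact ⟨a ≫ b, by simp [reassoc_of% h']⟩
  exact IsIso.of_isIso_comp_right m e.inv

/-- The coprojections of a colimit are extremal epimorphic. -/
lemma isExtremalEpic_of_isColimit {J : Type*} [Category* J] {F : J ⥤ E} {c : Cocone F}
    (hc : IsColimit c) : IsExtremalEpic (Presieve.ofArrows F.obj c.ι.app) := fun U m _ hm => by
  choose l hl using fun j => hm (Presieve.ofArrows.mk (f := c.ι.app) j)
  let c' : Cocone F :=
    { pt := U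
      ι :=
        { app := l
          naturality := fun i j f => by
            rw [← cancel_mono m]
            simp [hl] } }
  have h : hc.desc c' ≫ m = 𝟙 c.pt := hc.hom_ext fun j => by
    rw [hc.fac_assoc]
    exact (hl j).trans (Category.comp_id _).symm
  exact ⟨hc.desc c', by rw [← cancel_mono m, Category.assoc, h]; simp, h⟩

instance hasIsos_extremal [HasTerminal E] :
    (pullbackClosure (extremalEpicFamilies.{w} E)).HasIsos :=
  hasIsos_pullbackClosure terminalIsTerminal ⟨fun U m _ hm => by
    obtain ⟨l, hl⟩ := hm (Presieve.singleton_self _)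
    exact ⟨l, by rw [← cancel_mono m, Category.assoc, hl]; simp, hl⟩,
    PUnit, fun _ => _, fun _ => 𝟙 _, (Presieve.ofArrows_pUnit _).symm⟩

variable (E) in
/-- The Grothendieck topology given by the continuous `κ`-cotrees of extremal epimorphic families. -/
def extremalTopology (κ : Cardinal.{w}) [Fact κ.IsRegular] [IsLexCategory κ E] :
    GrothendieckTopology E :=
  haveI := IsLexCategory.hasFiniteLimits κ E
  treeTopology (pullbackClosure (extremalEpicFamilies.{w} E)) κ

variable {κ : Cardinal.{w}} [Fact κ.IsRegular] [IsLexCategory κ E]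

lemma mem_extremalTopology_of_isExtremalEpic {X : E} {S : Sieve X} {ι : Type w} {Y : ι → E}
    {f : ∀ i, Y i ⟶ X} (h : IsExtremalEpic (Presieve.ofArrows Y f)) (hS : ∀ i, S (f i)) :
    S ∈ extremalTopology E κ X := by
  have := IsLexCategory.hasFiniteLimits κ E
  refine GrothendieckTopology.superset_covering _
    ((Sieve.generate_le_iff _ _).2 (Presieve.ofArrows_le_iff.2 hS))
    (generate_mem_treeTopology
      (le_pullbackClosure (K := extremalEpicFamilies.{w} E) _ ⟨h, _, _, _, rfl⟩))

lemma iInf_mem_extremalTopology {X : E} {I : Type w} (hI : HasCardinalLT I κ) {S : I → Sieve X}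
    (hS : ∀ i, S i ∈ extremalTopology E κ X) : ⨅ i, S i ∈ extremalTopology E κ X :=
  haveI := IsLexCategory.hasFiniteLimits κ E
  iInf_mem_treeTopology hI hS

/-- Compatibility with `< κ`-limits enters here: the tree family contained in the sieve is extremal
epimorphic, and enlarging a family preserves this. -/
lemma isExtremalEpic_of_mem_extremalTopology
    (hE : IsCompatible κ (extremalEpicFamilies.{w} E)) {X : E} {S : Sieve X}
    (hS : S ∈ extremalTopology E κ X) : IsExtremalEpic S.arrows := by
  have := IsLexCategory.hasFiniteLimits κ E
  obtain ⟨X', e, R, hR, hRS⟩ := exists_isTreeFamily_of_mem_treeTopology hS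
  exact (hE.tree R hR).of_iso e fun Z r hr => ⟨Z, 𝟙 Z, r ≫ e.hom, hRS _ _ hr, Category.id_comp _⟩

end Extremal

/-! ### Images of trees under `κ`-lex functors. -/

section Map

variable {C : Type u} [Category.{v} C] {E : Type*} [Category* E] {κ : Cardinal.{w}}
  [Fact κ.IsRegular] {M : C ⥤ E} {Q : Precoverage C} {Q' : Precoverage E} {X : C}

/-- The image of a tree by a `κ`-lex functor. -/
def TreeCover.map (hM : IsLexFunctor κ M) (hQ : ∀ ⦃X : C⦄ (R : Presieve X), R ∈ Q X →
    R.map M ∈ Q' (M.obj X)) (D : TreeCover Q κ X) : TreeCover Q' κ (M.obj X) where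
  T := D.T
  le_total_of_le := D.le_total_of_le
  hasCardinalLT_of_isChain := D.hasCardinalLT_of_isChain
  bddAbove_of_isChain := D.bddAbove_of_isChain
  diagram := D.diagram ⋙ M
  root := M.mapIso D.root
  leaves := D.leaves
  isMax_of_mem_leaves := D.isMax_of_mem_leaves
  covering t ht := by
    have := hQ _ (D.covering t ht)
    rwa [Presieve.map_ofArrows] at this
  continuous t ht := by
    obtain ⟨h⟩ := (isLimitBelow_iff _ _).1 (D.continuous t ht)
    -- The vertices below `t` form a chain, so the limit at `t` is a `< κ`-limit and is preserved by
    -- `M`.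
    have hc : HasCardinalLT (Set.Iio t) κ := D.hasCardinalLT_of_isChain _ fun a ha b hb _ =>
      D.le_total_of_le (le_of_lt ha) (le_of_lt hb)
    obtain ⟨_⟩ := hM ((Set.Iio t)ᵒᵖ) (hasCardinalLT_arrow_of_isThin κ _
      (hc.of_injective unop unop_injective))
    exact (isLimitBelow_iff _ _).2 ⟨isLimitOfPreserves M h⟩

lemma TreeCover.map_covers (hM : IsLexFunctor κ M) (hQ : ∀ ⦃X : C⦄ (R : Presieve X), R ∈ Q X →
    R.map M ∈ Q' (M.obj X)) {D : TreeCover Q κ X} {S : Sieve X} (hS : D.Covers S)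
    {S' : Sieve (M.obj X)} (hSS' : ∀ ⦃Y : C⦄ ⦃f : Y ⟶ X⦄, S f → S' (M.map f)) :
    (D.map hM hQ).Covers S' := fun t ht => by
  have : (D.map hM hQ).str t = M.map (D.str t) := (M.map_comp _ _).symm
  rw [this]
  exact hSS' (hS t ht)

end Map

section MapSmall

variable {C : Type w} [SmallCategory C] {E : Type u} [Category.{v} E] {κ : Cardinal.{w}}
  [Fact κ.IsRegular] {M : C ⥤ E} {K : Precoverage C}

lemma map_mem_pullbackClosure (hM : IsLexFunctor κ M)
    (hK : ∀ ⦃X : C⦄ (R : Presieve X), R ∈ K X → IsExtremalEpic (R.map M)) {X : C}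
    (R : Presieve X) (hR : R ∈ pullbackClosure K X) :
    R.map M ∈ pullbackClosure (extremalEpicFamilies.{w} E) (M.obj X) := by
  have := hM.preservesFiniteLimits
  obtain ⟨Y, f, ι, Z, g, P, p, q, hg, hp, rfl⟩ := hR
  have hg' := hK _ hg
  rw [Presieve.map_ofArrows] at hg' ⊢
  exact Precoverage.mem_coverings_of_isPullback (J := pullbackClosure (extremalEpicFamilies.{w} E))
    (fun i => M.map (g i)) (le_pullbackClosure _ ⟨hg', _, _, _, rfl⟩) (M.map f)
    (fun i => M.map (p i)) (fun i => M.map (q i)) fun i => (hp i).map M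

lemma mem_extremalTopology_of_isLexFunctor [IsLexCategory κ C] [IsLexCategory κ E]
    [(pullbackClosure K).HasIsos] (hM : IsLexFunctor κ M)
    (hK : ∀ ⦃X : C⦄ (R : Presieve X), R ∈ K X → IsExtremalEpic (R.map M)) {X : C} {S : Sieve X}
    (hS : S ∈ treeTopology (pullbackClosure K) κ X) {S' : Sieve (M.obj X)}
    (hSS' : ∀ ⦃Y : C⦄ ⦃f : Y ⟶ X⦄, S f → S' (M.map f)) : S' ∈ extremalTopology E κ (M.obj X) := by
  obtain ⟨D, hD⟩ := hS
  exact ⟨_, TreeCover.map_covers hM (fun _ => map_mem_pullbackClosure hM hK) hD hSS'⟩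

end MapSmall

end KappaTopos

/-! ### Finite limits and extension along the Yoneda embedding. -/

namespace KappaTopos

section Dense

variable {A B E : Type*} [Category* A] [Category* B] [Category* E]

lemma isLeftKanExtension_of_isDense (F : A ⥤ B) [F.IsDense] (N : B ⥤ E)
    [∀ Y, PreservesColimit (CostructuredArrow.proj F Y ⋙ F) N] :
    N.IsLeftKanExtension (𝟙 (F ⋙ N)) := by
  have h : (Functor.LeftExtension.mk N (𝟙 (F ⋙ N))).IsPointwiseLeftKanExtension := fun Y =>
    IsColimit.ofIsoColimit (isColimitOfPreserves N (F.denseAt Y)) (Cocone.ext (Iso.refl _)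
      fun j => by
        change N.map (𝟙 _ ≫ j.hom) ≫ 𝟙 _ = 𝟙 _ ≫ N.map j.hom
        simp)
  exact h.isLeftKanExtension

end Dense

section Presheaves

variable {C : Type w} [SmallCategory C] {E : Type u} [Category.{v} E]

lemma isLeftKanExtension_yoneda (L : (Cᵒᵖ ⥤ Type w) ⥤ E) [PreservesColimitsOfSize.{w, w} L] :
    L.IsLeftKanExtension (𝟙 (yoneda ⋙ L)) :=
  isLeftKanExtension_of_isDense _ _

lemma nonempty_iso_of_yoneda_comp {L L' : (Cᵒᵖ ⥤ Type w) ⥤ E} [PreservesColimitsOfSize.{w, w} L]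
    [PreservesColimitsOfSize.{w, w} L'] (e : yoneda ⋙ L ≅ yoneda ⋙ L') : Nonempty (L ≅ L') :=
  haveI := isLeftKanExtension_yoneda L
  haveI := isLeftKanExtension_yoneda L'
  ⟨L.leftKanExtensionUniqueOfIso (𝟙 (yoneda ⋙ L)) e L' (𝟙 (yoneda ⋙ L'))⟩

end Presheaves

section Presheaves

variable {C : Type w} [SmallCategory C] {E : Type u} [Category.{w} E]
  [HasColimitsOfSize.{w, w} E]

lemma exists_extension (M : C ⥤ E) : ∃ L : (Cᵒᵖ ⥤ Type w) ⥤ E,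
    L.IsLeftAdjoint ∧ Nonempty (yoneda ⋙ L ≅ M) := by
  refine ⟨uliftYoneda.{w}.leftKanExtension M,
    ⟨_, ⟨Presheaf.uliftYonedaAdjunction _ (uliftYoneda.leftKanExtensionUnit M)⟩⟩,
    ⟨Functor.isoWhiskerRight uliftYonedaIsoYoneda.symm _ ≪≫
      Presheaf.isExtensionAlongULiftYoneda.{w} M⟩⟩

/-- The category of elements of the left exact functor `yoneda ⋙ P` is cofiltered, which exhibits
`P` as a filtered colimit of evaluation functors. -/
lemma preservesFiniteLimits_type [HasFiniteLimits C] (P : (Cᵒᵖ ⥤ Type w) ⥤ Type w)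
    [PreservesColimitsOfSize.{w, w} P] [PreservesFiniteLimits (yoneda ⋙ P)] :
    PreservesFiniteLimits P := by
  have := Functor.isCofiltered_elements (yoneda ⋙ P)
  let P' : (Cᵒᵖ ⥤ Type w) ⥤ Type w :=
    (Functor.whiskeringLeft _ _ _).obj (CategoryOfElements.π (yoneda ⋙ P)).op ⋙ colim
  have : PreservesColimitsOfSize.{w, w} P' := ⟨inferInstance⟩
  have : PreservesFiniteLimits P' := comp_preservesFiniteLimits _ _
  obtain ⟨i⟩ := nonempty_iso_of_yoneda_comp (L := P') (L' := P)
    (Functor.isoWhiskerRight shrinkYonedaIsoYoneda.symm _ ≪≫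
      Functor.Elements.shrinkYonedaCompWhiskeringLeftObjπCompColimIso (yoneda ⋙ P))
  exact preservesFiniteLimits_of_natIso i

lemma preservesFiniteLimits_presheaf [HasFiniteLimits C] {D : Type w} [SmallCategory D]
    (P : (Cᵒᵖ ⥤ Type w) ⥤ (Dᵒᵖ ⥤ Type w))
    [PreservesColimitsOfSize.{w, w} P] [PreservesFiniteLimits (yoneda ⋙ P)] :
    PreservesFiniteLimits P where
  preservesFiniteLimits J _ _ := preservesLimitsOfShape_of_evaluation _ _ fun d => by
    have : PreservesColimitsOfSize.{w, w} ((evaluation _ (Type w)).obj d : (Dᵒᵖ ⥤ Type w) ⥤ _) :=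
      ⟨inferInstance⟩
    have : PreservesFiniteLimits (yoneda ⋙ P ⋙ (evaluation _ _).obj d) :=
      comp_preservesFiniteLimits (yoneda ⋙ P) ((evaluation _ _).obj d)
    have := preservesFiniteLimits_type (P ⋙ (evaluation _ _).obj d)
    infer_instance

omit [HasColimitsOfSize.{w, w} E] in
-- The inclusion of sheaves into presheaves is not cocontinuous in general, so the composite with it
-- is re-extended from representables to `G`. The presheaf case applies to `G`, and sheafifying `G`
-- recovers `L` because both are cocontinuous and agree on representables.
lemma preservesFiniteLimits_of_yoneda_comp [HasFiniteLimits C] [IsGrothendieckTopos E]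
    (L : (Cᵒᵖ ⥤ Type w) ⥤ E) [PreservesColimitsOfSize.{w, w} L]
    [PreservesFiniteLimits (yoneda ⋙ L)] : PreservesFiniteLimits L := by
  obtain ⟨D, _, J, ⟨e⟩⟩ := IsGrothendieckTopos.exists_equivalence (E := E)
  obtain ⟨G, _, ⟨i⟩⟩ := exists_extension (yoneda ⋙ L ⋙ e.functor ⋙ sheafToPresheaf J (Type w))
  have : PreservesColimitsOfSize.{w, w} G :=
    (Adjunction.ofIsLeftAdjoint G).leftAdjoint_preservesColimits
  have : PreservesFiniteLimits (yoneda ⋙ L ⋙ e.functor ⋙ sheafToPresheaf J (Type w)) :=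
    comp_preservesFiniteLimits (yoneda ⋙ L) (e.functor ⋙ sheafToPresheaf J (Type w))
  have := preservesFiniteLimits_of_natIso i.symm
  have := preservesFiniteLimits_presheaf G
  have hG : PreservesFiniteLimits (G ⋙ presheafToSheaf J (Type w)) :=
    comp_preservesFiniteLimits _ _
  have : PreservesColimitsOfSize.{w, w} (presheafToSheaf J (Type w)) :=
    (sheafificationAdjunction J (Type w)).leftAdjoint_preservesColimits
  obtain ⟨k⟩ := nonempty_iso_of_yoneda_comp (L := G ⋙ presheafToSheaf J (Type w) ⋙ e.inverse)
    (L' := L) (Functor.isoWhiskerRight i (presheafToSheaf J (Type w) ⋙ e.inverse) ≪≫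
      Functor.isoWhiskerLeft (yoneda ⋙ L ⋙ e.functor)
        (Functor.isoWhiskerRight (asIso (sheafificationAdjunction J (Type w)).counit) e.inverse) ≪≫
      Functor.isoWhiskerLeft (yoneda ⋙ L) e.unitIso.symm)
  have : PreservesFiniteLimits (G ⋙ presheafToSheaf J (Type w) ⋙ e.inverse) :=
    comp_preservesFiniteLimits (G ⋙ presheafToSheaf J (Type w)) e.inverse
  exact preservesFiniteLimits_of_natIso k

end Presheaves

end KappaTopos

/-! ### Preservation of products of fewer than `κ` presheaves. -/

namespace KappaTopos

variable {C : Type w} [SmallCategory C] {E : Type u} [Category.{v} E]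
  {L : (Cᵒᵖ ⥤ Type w) ⥤ E} {κ : Cardinal.{w}} [Fact κ.IsRegular]

variable (L) in
/-- The sieve on `L.obj F` generated by the images of the elements of the presheaf `F`. -/
def elementsSieve (F : Cᵒᵖ ⥤ Type w) : Sieve (L.obj F) where
  arrows W f := ∃ (c : C) (x : yoneda.obj c ⟶ F) (u : W ⟶ L.obj (yoneda.obj c)), u ≫ L.map x = f
  downward_closed := by
    rintro W W' _ ⟨c, x, u, rfl⟩ g
    exact ⟨c, x, g ≫ u, Category.assoc _ _ _⟩

lemma isExtremalEpic_elements [PreservesColimitsOfSize.{w, w} L] (F : Cᵒᵖ ⥤ Type w) :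
    IsExtremalEpic (Presieve.ofArrows (fun j : CostructuredArrow yoneda F =>
      L.obj (yoneda.obj j.left)) (fun j => L.map j.hom)) :=
  isExtremalEpic_of_isColimit (isColimitOfPreserves L (Presheaf.isColimitTautologicalCocone F))

variable [IsLexCategory κ E]

lemma elementsSieve_mem [PreservesColimitsOfSize.{w, w} L] (F : Cᵒᵖ ⥤ Type w) :
    elementsSieve L F ∈ extremalTopology E κ (L.obj F) :=
  mem_extremalTopology_of_isExtremalEpic (isExtremalEpic_elements F)
    fun j => ⟨j.left, j.hom, 𝟙 _, Category.id_comp _⟩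

/-- The sieve of the arrows along which a generalized element `u` of `L.obj (yoneda.obj t)` lifts to
an object on which the elements `x` and `x'` of `F` agree. -/
def equalizingSieve {F : Cᵒᵖ ⥤ Type w} {t : C} (x x' : yoneda.obj t ⟶ F) {W : E}
    (u : W ⟶ L.obj (yoneda.obj t)) : Sieve W where
  arrows V h := ∃ (d : C) (a : d ⟶ t) (v : V ⟶ L.obj (yoneda.obj d)),
    yoneda.map a ≫ x = yoneda.map a ≫ x' ∧ v ≫ L.map (yoneda.map a) = h ≫ u
  downward_closed := by
    rintro V V' h ⟨d, a, v, h₁, h₂⟩ g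
    exact ⟨d, a, g ≫ v, h₁, by simp [h₂]⟩

/-- As `L` preserves equalizers, `u` factors through `L` of the equalizer of `x` and `x'`, which is
covered by images of its elements. -/
lemma equalizingSieve_mem [PreservesColimitsOfSize.{w, w} L] [PreservesFiniteLimits L]
    {F : Cᵒᵖ ⥤ Type w} {t : C} (x x' : yoneda.obj t ⟶ F) {W : E}
    (u : W ⟶ L.obj (yoneda.obj t)) (hu : u ≫ L.map x = u ≫ L.map x') :
    equalizingSieve x x' u ∈ extremalTopology E κ W := by
  obtain ⟨l, hl⟩ := Fork.IsLimit.lift' (isLimitOfHasEqualizerOfPreservesLimit L x x') u hu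
  refine GrothendieckTopology.superset_covering _ ?_
    (GrothendieckTopology.pullback_stable _ l (elementsSieve_mem (equalizer x x')))
  rintro V h ⟨d, z, v, hv⟩
  refine ⟨d, yoneda.preimage (z ≫ equalizer.ι x x'), v, ?_, ?_⟩
  · rw [yoneda.map_preimage]
    exact (Category.assoc _ _ _).trans ((congrArg (z ≫ ·) (equalizer.condition x x')).trans
      (Category.assoc _ _ _).symm)
  · rw [yoneda.map_preimage, L.map_comp, reassoc_of% hv, ← hl]
    rfl

omit [IsLexCategory κ E] in
-- The witness is the wide pullback of the `d i` over `t`, preserved by `yoneda ⋙ L`; it replaces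
-- many refinements of `t` by a single one.
lemma exists_lift_of_forall [IsLexCategory κ C] {I : Type w} (hI : HasCardinalLT I κ)
    (hM : IsLexFunctor κ (yoneda ⋙ L)) {t : C} {W : E} (u : W ⟶ L.obj (yoneda.obj t)) {d : I → C}
    (a : ∀ i, d i ⟶ t) (v : ∀ i, W ⟶ L.obj (yoneda.obj (d i)))
    (hv : ∀ i, v i ≫ L.map (yoneda.map (a i)) = u) :
    ∃ (e : C) (b : e ⟶ t) (p : ∀ i, e ⟶ d i) (z : W ⟶ L.obj (yoneda.obj e)),
      (∀ i, p i ≫ a i = b) ∧ z ≫ L.map (yoneda.map b) = u := by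
  have hI' := hasCardinalLT_arrow_of_isThin κ (WidePullbackShape I) (hasCardinalLT_option κ hI)
  have := hasLimitsOfShape_widePullbackShape (C := C) κ hI
  obtain ⟨_⟩ := hM _ hI'
  let F := WidePullbackShape.wideCospan t d a
  let s : Cone (F ⋙ yoneda ⋙ L) := WidePullbackShape.mkCone u v hv
  exact ⟨widePullback t d a, WidePullback.base a, WidePullback.π a,
    (isLimitOfPreserves (yoneda ⋙ L) (limit.isLimit F)).lift s, WidePullback.π_arrow a,
    (isLimitOfPreserves (yoneda ⋙ L) (limit.isLimit F)).fac s none⟩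

lemma exists_prod_lift {A B : Type*} [Category* A] [Category* B] [HasBinaryProducts A]
    [HasBinaryProducts B] {M : A ⥤ B} [PreservesLimitsOfShape (Discrete WalkingPair) M] {c c' : A}
    {W : B} (u : W ⟶ M.obj c) (u' : W ⟶ M.obj c') :
    ∃ q : W ⟶ M.obj (c ⨯ c'), q ≫ M.map prod.fst = u ∧ q ≫ M.map prod.snd = u' :=
  ⟨prod.lift u u' ≫ inv (prodComparison M c c'), by
    rw [Category.assoc, inv_prodComparison_map_fst, prod.lift_fst], by
    rw [Category.assoc, inv_prodComparison_map_snd, prod.lift_snd]⟩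

lemma exists_pi_lift {A B : Type*} [Category* A] [Category* B] {I : Type w}
    [HasLimitsOfShape (Discrete I) A] {M : A ⥤ B} [PreservesLimitsOfShape (Discrete I) M]
    {c : I → A} {W : B} (v : ∀ i, W ⟶ M.obj (c i)) :
    ∃ z : W ⟶ M.obj (∏ᶜ c), ∀ i, z ≫ M.map (Pi.π c i) = v i := by
  let s : Cone (Discrete.functor c ⋙ M) :=
    { pt := W
      π := Discrete.natTrans fun i => v i.as }
  exact ⟨(isLimitOfPreserves M (limit.isLimit (Discrete.functor c))).lift s,
    fun i => (isLimitOfPreserves M (limit.isLimit (Discrete.functor c))).fac s ⟨i⟩⟩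

variable [IsLexCategory κ C] [PreservesColimitsOfSize.{w, w} L] [PreservesFiniteLimits L]

lemma mono_piComparison (hE : IsCompatible κ (extremalEpicFamilies.{w} E)) {I : Type w}
    (hI : HasCardinalLT I κ) (hM : IsLexFunctor κ (yoneda ⋙ L)) (F : I → (Cᵒᵖ ⥤ Type w))
    [HasProduct fun i => L.obj (F i)] : Mono (piComparison L F) := by
  have := IsLexCategory.hasFiniteLimits κ C
  have := IsLexCategory.hasFiniteLimits κ E
  have := hM.preservesFiniteLimits
  refine ⟨fun {W} f g hfg => ?_⟩
  have hfg' (i : I) : f ≫ L.map (Pi.π F i) = g ≫ L.map (Pi.π F i) := by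
    simpa using hfg =≫ Pi.π _ i
  refine (isExtremalEpic_of_mem_extremalTopology hE (GrothendieckTopology.intersection_covering _
    (GrothendieckTopology.pullback_stable _ f (elementsSieve_mem (κ := κ) _))
    (GrothendieckTopology.pullback_stable _ g (elementsSieve_mem _)))).hom_ext ?_
  rintro W' r ⟨⟨c, x, u, hu⟩, c', x', u', hu'⟩
  -- Passing to `c ⨯ c'` represents both arrows by elements `y` and `y'` of the product presheaf
  -- over one representable, evaluated at the same `q`.
  obtain ⟨q, hq, hq'⟩ := exists_prod_lift (M := yoneda ⋙ L) u u'
  obtain ⟨y, hy⟩ : ∃ y : yoneda.obj (c ⨯ c') ⟶ ∏ᶜ F, q ≫ L.map y = r ≫ f :=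
    ⟨yoneda.map prod.fst ≫ x, by
      rw [← hu, ← hq, L.map_comp, Category.assoc]
      rfl⟩
  obtain ⟨y', hy'⟩ : ∃ y' : yoneda.obj (c ⨯ c') ⟶ ∏ᶜ F, q ≫ L.map y' = r ≫ g :=
    ⟨yoneda.map prod.snd ≫ x', by
      rw [← hu', ← hq', L.map_comp, Category.assoc]
      rfl⟩
  -- For each `i` the `i`-th components of `y` and `y'` agree after a local refinement; intersecting
  -- the sieves gives all these refinements on one cover, to be merged by `exists_lift_of_forall`.
  refine (isExtremalEpic_of_mem_extremalTopology hE (iInf_mem_extremalTopology hI fun i =>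
    equalizingSieve_mem (y ≫ Pi.π F i) (y' ≫ Pi.π F i) q ?_)).hom_ext fun V h hh => ?_
  · rw [L.map_comp, L.map_comp, reassoc_of% hy, reassoc_of% hy', hfg']
  · choose d a v h₁ h₂ using fun i => hh _ ⟨i, rfl⟩
    obtain ⟨e, b, p, z, hp, hz⟩ := exists_lift_of_forall hI hM (h ≫ q) a v h₂
    have hb : yoneda.map b ≫ y = yoneda.map b ≫ y' := Pi.hom_ext _ _ fun i => by
      rw [← hp i, Functor.map_comp, Category.assoc, Category.assoc, Category.assoc, Category.assoc,
        h₁]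
    rw [← hy, ← hy', ← Category.assoc, ← Category.assoc, ← hz, Category.assoc, Category.assoc,
      ← L.map_comp, ← L.map_comp, hb]

lemma isIso_piComparison (hE : IsCompatible κ (extremalEpicFamilies.{w} E)) {I : Type w}
    (hI : HasCardinalLT I κ) (hM : IsLexFunctor κ (yoneda ⋙ L)) (F : I → (Cᵒᵖ ⥤ Type w))
    [HasProduct fun i => L.obj (F i)] : IsIso (piComparison L F) := by
  have := mono_piComparison hE hI hM F
  have hI' := hasCardinalLT_arrow_discrete hI
  have := IsLexCategory.hasLimitsOfShape (κ := κ) (C := C) _ hI'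
  have := IsLexCategory.hasLimitsOfShape (κ := κ) (C := E) _ hI'
  obtain ⟨_⟩ := hM _ hI'
  -- The comparison is monic, so it is enough that a covering sieve of the product factors through
  -- it. On the intersection of the pulled-back element sieves, all components come from elements
  -- simultaneously.
  refine isExtremalEpic_of_mem_extremalTopology hE (iInf_mem_extremalTopology hI fun i =>
    GrothendieckTopology.pullback_stable _ (Pi.π _ i) (elementsSieve_mem (F i))) _
    fun V h hh => ?_
  choose c x v hv using fun i => hh _ ⟨i, rfl⟩
  obtain ⟨z, hz⟩ := exists_pi_lift (M := yoneda ⋙ L) v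
  refine ⟨z ≫ L.map (Pi.lift fun i => yoneda.map (Pi.π c i) ≫ x i), Pi.hom_ext _ _ fun i => ?_⟩
  rw [Category.assoc, Category.assoc, piComparison_comp_π, ← L.map_comp, Pi.lift_π, L.map_comp,
    ← hv i, ← hz i, Category.assoc]
  rfl

theorem isLexFunctor_of_yoneda_comp (hE : IsCompatible κ (extremalEpicFamilies.{w} E))
    (hM : IsLexFunctor κ (yoneda ⋙ L)) : IsLexFunctor κ L := by
  have : IsLexCategory κ (Cᵒᵖ ⥤ Type w) := ⟨fun _ _ _ => inferInstance⟩
  refine isLexFunctor_of_preservesProducts fun I hI => ?_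
  have := IsLexCategory.hasLimitsOfShape (κ := κ) (C := E) _ (hasCardinalLT_arrow_discrete hI)
  have (F : I → (Cᵒᵖ ⥤ Type w)) : PreservesLimit (Discrete.functor F) L := by
    have := isIso_piComparison hE hI hM F
    exact PreservesProduct.of_iso_comparison _ _
  exact preservesLimitsOfShape_of_discrete L

end KappaTopos

/-! ### From presheaves to sheaves. -/

namespace KappaTopos

section Functors

variable {κ : Cardinal.{w}} {C D E : Type*} [Category* C] [Category* D] [Category* E]

lemma IsLexFunctor.comp {F : C ⥤ D} {G : D ⥤ E} (hF : IsLexFunctor κ F) (hG : IsLexFunctor κ G) :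
    IsLexFunctor κ (F ⋙ G) := fun J _ hJ => by
  obtain ⟨_⟩ := hF J hJ
  obtain ⟨_⟩ := hG J hJ
  exact ⟨inferInstance⟩

lemma IsLexFunctor.of_iso {F G : C ⥤ D} (e : F ≅ G) (hF : IsLexFunctor κ F) : IsLexFunctor κ G :=
  fun J _ hJ => by
    obtain ⟨_⟩ := hF J hJ
    exact ⟨preservesLimitsOfShape_of_natIso e⟩

lemma isLexFunctor_of_isRightAdjoint (F : C ⥤ D) [F.IsRightAdjoint] : IsLexFunctor κ F :=
  fun _ _ _ => ⟨inferInstance⟩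

lemma isLexFunctor_yoneda {C : Type w} [SmallCategory C] :
    IsLexFunctor κ (yoneda : C ⥤ Cᵒᵖ ⥤ Type w) :=
  fun _ _ _ => ⟨inferInstance⟩

lemma IsCocontinuous.of_iso {F G : C ⥤ D} (e : F ≅ G) (hF : IsCocontinuous.{w} F) :
    IsCocontinuous.{w} G := by
  obtain ⟨_⟩ := hF
  exact ⟨preservesColimits_of_natIso e⟩

end Functors

section Sheaves

variable {C : Type w} [SmallCategory C] {J : GrothendieckTopology C} {E : Type u} [Category.{w} E]
  {L : (Cᵒᵖ ⥤ Type w) ⥤ E}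

lemma functorInclusion_mem_W {X : C} {S : Sieve X} (hS : S ∈ J X) : J.W S.functorInclusion := by
  intro P hP
  rw [isSheaf_iff_isSheaf_of_type] at hP
  exact (Function.bijective_iff_existsUnique _).2
    (Presieve.isSheafFor_iff_yonedaSheafCondition.1 (hP S hS))

lemma isSheaf_of_adjunction {R : E ⥤ (Cᵒᵖ ⥤ Type w)} (adj : L ⊣ R)
    (hL : ∀ ⦃X : C⦄ (S : Sieve X), S ∈ J X → IsIso (L.map S.functorInclusion)) (Z : E) :
    Presheaf.IsSheaf J (R.obj Z) := by
  rw [isSheaf_iff_isSheaf_of_type]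
  intro X S hS
  have := hL S hS
  exact Presieve.isSheafFor_iff_yonedaSheafCondition.2 ((Function.bijective_iff_existsUnique _).1
    ((adj.map_comp_bijective_iff S.functorInclusion Z).1
      ((isIso_iff_coyoneda_map_bijective _).1 inferInstance Z)))

lemma isIso_map_of_W [L.IsLeftAdjoint]
    (hL : ∀ ⦃X : C⦄ (S : Sieve X), S ∈ J X → IsIso (L.map S.functorInclusion))
    {F G : Cᵒᵖ ⥤ Type w} {f : F ⟶ G} (hf : J.W f) : IsIso (L.map f) :=
  isIso_of_coyoneda_map_bijective _ fun Z =>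
    ((Adjunction.ofIsLeftAdjoint L).map_comp_bijective_iff f Z).2
      (hf _ (isSheaf_of_adjunction (Adjunction.ofIsLeftAdjoint L) hL Z))

/-- Because `L` inverts the sieve inclusions, its right adjoint takes values in sheaves, and the
adjunction restricts. -/
lemma isLeftAdjoint_sheafToPresheaf_comp [L.IsLeftAdjoint]
    (hL : ∀ ⦃X : C⦄ (S : Sieve X), S ∈ J X → IsIso (L.map S.functorInclusion)) :
    (sheafToPresheaf J (Type w) ⋙ L).IsLeftAdjoint := by
  let R : E ⥤ Sheaf J (Type w) := ObjectProperty.lift _ L.rightAdjoint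
    (isSheaf_of_adjunction (Adjunction.ofIsLeftAdjoint L) hL)
  exact ⟨R, ⟨(Adjunction.ofIsLeftAdjoint L).restrictFullyFaithful
    (fullyFaithfulSheafToPresheaf J (Type w)) (Functor.FullyFaithful.id E)
    (Iso.refl _) (Iso.refl _)⟩⟩

lemma nonempty_presheafToSheaf_comp_iso [L.IsLeftAdjoint]
    (hL : ∀ ⦃X : C⦄ (S : Sieve X), S ∈ J X → IsIso (L.map S.functorInclusion)) :
    Nonempty (presheafToSheaf J (Type w) ⋙ sheafToPresheaf J (Type w) ⋙ L ≅ L) := by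
  have (F : Cᵒᵖ ⥤ Type w) : IsIso (L.map (toSheafify J F)) :=
    isIso_map_of_W hL (J.W_toSheafify F)
  exact ⟨(NatIso.ofComponents (F := L)
    (G := presheafToSheaf J (Type w) ⋙ sheafToPresheaf J (Type w) ⋙ L)
    (fun F => asIso (L.map (toSheafify J F))) fun f => by
    change L.map f ≫ L.map _ = L.map _ ≫ L.map (sheafifyMap J f)
    rw [← L.map_comp, ← L.map_comp, toSheafify_naturality]).symm⟩

/-- A cocontinuous functor on a category of sheaves is the left Kan extension of its restriction
along the sheafified Yoneda embedding. -/
lemma isLeftKanExtension_of_isCocontinuous {N : Sheaf J (Type w) ⥤ E} (hN : IsCocontinuous.{w} N) :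
    N.IsLeftKanExtension (𝟙 ((yoneda ⋙ presheafToSheaf J (Type w)) ⋙ N)) := by
  obtain ⟨_⟩ := hN
  have : PreservesColimitsOfSize.{w, w} (presheafToSheaf J (Type w)) :=
    (sheafificationAdjunction J (Type w)).leftAdjoint_preservesColimits
  have h₁ := isLeftKanExtension_yoneda (presheafToSheaf J (Type w) ⋙ N)
  -- Sheafification is a localization at `J.W`, and a right derived functor along a localization is
  -- a left Kan extension.
  have h₂ : N.IsLeftKanExtension (𝟙 (presheafToSheaf J (Type w) ⋙ N)) := by
    have := Functor.isRightDerivedFunctor_of_inverts J.W N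
      (Iso.refl (presheafToSheaf J (Type w) ⋙ N))
    exact (Functor.isRightDerivedFunctor_iff_isLeftKanExtension _ _ _).1 this
  refine (Functor.isLeftKanExtension_iff_postcompose
    (𝟙 (yoneda ⋙ presheafToSheaf J (Type w) ⋙ N)) (yoneda ⋙ presheafToSheaf J (Type w))
    (Iso.refl _) (𝟙 (presheafToSheaf J (Type w) ⋙ N)) _ (NatTrans.ext (funext fun X => ?_))).1 h₂
  exact (Category.id_comp _).trans ((Category.id_comp _).trans ((Category.id_comp _).trans
    (N.map_id _)))

end Sheaves

/-! ### Extension of models to sheaves. -/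

section Extension

variable {κ : Cardinal.{w}} [Fact κ.IsRegular] {C : Type w} [SmallCategory C] {K : Precoverage C}
  {E : Type u} [Category.{w} E] {L : (Cᵒᵖ ⥤ Type w) ⥤ E}

lemma IsKappaSite.hasIsos_pullbackClosure (hK : IsKappaSite κ K) :
    haveI := hK.isLexCategory
    haveI := IsLexCategory.hasFiniteLimits κ C
    (pullbackClosure K).HasIsos := by
  have := hK.isLexCategory
  have := IsLexCategory.hasFiniteLimits κ C
  obtain ⟨T, ⟨hT⟩, h⟩ := hK.id_mem
  exact KappaTopos.hasIsos_pullbackClosure hT h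

lemma IsKappaSite.topology_eq (hK : IsKappaSite κ K) :
    haveI := hK.isLexCategory
    haveI := IsLexCategory.hasFiniteLimits κ C
    haveI := hK.hasIsos_pullbackClosure
    topology κ K = treeTopology (pullbackClosure K) κ :=
  haveI := hK.isLexCategory
  haveI := IsLexCategory.hasFiniteLimits κ C
  haveI := hK.hasIsos_pullbackClosure
  toGrothendieck_treeClosure

/-- The arrow is monic since `L` is left exact. Every image of an arrow of `S` factors through it,
so it generates a covering sieve in `E`; an extremal epimorphic monomorphism is invertible. -/
lemma isIso_map_functorInclusion (hK : IsKappaSite κ K) (hE : IsInftyCoherent κ E)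
    (hL : IsLexFunctor κ L) (hM : IsLexFunctor κ (yoneda ⋙ L))
    (hKM : PreservesFamilies K (yoneda ⋙ L)) {X : C} (S : Sieve X) (hS : S ∈ topology κ K X) :
    IsIso (L.map S.functorInclusion) := by
  have := hK.isLexCategory
  have := hE.isLexCategory
  have := IsLexCategory.hasFiniteLimits κ C
  have := hK.hasIsos_pullbackClosure
  have := hL.preservesFiniteLimits
  have : Mono (L.map S.functorInclusion) := inferInstance
  rw [hK.topology_eq] at hS
  have h : Sieve.generate (Presieve.singleton (L.map S.functorInclusion)) ∈
      extremalTopology E κ ((yoneda ⋙ L).obj X) :=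
    mem_extremalTopology_of_isLexFunctor hM hKM hS fun Y f hf =>
      ⟨_, L.map (S.toFunctor f hf), _, Presieve.singleton_self _, by
        rw [← L.map_comp]
        rfl⟩
  refine isExtremalEpic_of_mem_extremalTopology hE.isCompatible h _ ?_
  rintro Y f ⟨Z, a, b, ⟨⟩, rfl⟩
  exact ⟨a, rfl⟩

theorem exists_isLexCocontinuous [IsGrothendieckTopos E] (hK : IsKappaSite κ K)
    (hE : IsInftyCoherent κ E) {M : C ⥤ E} (hM : IsLexFunctor κ M) (hKM : PreservesFamilies K M) :
    ∃ N : Sh κ K ⥤ E, isLexCocontinuous κ E (Sh κ K) N ∧ Nonempty (ay κ K ⋙ N ≅ M) := by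
  have := hK.isLexCategory
  have := hE.isLexCategory
  have := IsLexCategory.hasFiniteLimits κ C
  obtain ⟨L, _, ⟨e⟩⟩ := exists_extension M
  have : PreservesColimitsOfSize.{w, w} L :=
    (Adjunction.ofIsLeftAdjoint L).leftAdjoint_preservesColimits
  have hM' : IsLexFunctor κ (yoneda ⋙ L) := hM.of_iso e.symm
  have hKM' : PreservesFamilies K (yoneda ⋙ L) := fun X R hR =>
    (hKM R hR).of_iso (e.symm.app X) fun Z r hr => by
      obtain ⟨hr⟩ := hr
      exact ⟨_, e.inv.app _, _, Presieve.map_map hr, (e.inv.naturality _).symm⟩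
  have := hM'.preservesFiniteLimits
  have := preservesFiniteLimits_of_yoneda_comp L
  have hL := isLexFunctor_of_yoneda_comp hE.isCompatible hM'
  have hinv := fun X (S : Sieve X) => isIso_map_functorInclusion hK hE hL hM' hKM' S
  have := isLeftAdjoint_sheafToPresheaf_comp hinv
  obtain ⟨i⟩ := nonempty_presheafToSheaf_comp_iso hinv
  refine ⟨sheafToPresheaf _ _ ⋙ L, ⟨(isLexFunctor_of_isRightAdjoint _).comp hL,
    ⟨(Adjunction.ofIsLeftAdjoint _).leftAdjoint_preservesColimits⟩⟩,
    ⟨Functor.isoWhiskerLeft yoneda i ≪≫ e⟩⟩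

theorem isIso_lanUnit_app [IsGrothendieckTopos E] (hK : IsKappaSite κ K)
    (hE : IsInftyCoherent κ E) {M : C ⥤ E} (hM : IsLexFunctor κ M) (hKM : PreservesFamilies K M) :
    IsIso ((ay κ K).lanUnit.app M) ∧ isLexCocontinuous κ E (Sh κ K) ((ay κ K).lan.obj M) := by
  obtain ⟨N, hN, ⟨e⟩⟩ := exists_isLexCocontinuous hK hE hM hKM
  have := isLeftKanExtension_of_isCocontinuous hN.2
  let i := ((ay κ K).lan.obj M).leftKanExtensionUniqueOfIso ((ay κ K).lanUnit.app M) e.symm N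
    (𝟙 (ay κ K ⋙ N))
  have hi : (ay κ K).lanUnit.app M ≫ Functor.whiskerLeft (ay κ K) i.hom = e.inv ≫ 𝟙 _ :=
    Functor.descOfIsLeftKanExtension_fac _ _ _ _
  refine ⟨?_, hN.1.of_iso i.symm, hN.2.of_iso i.symm⟩
  have : IsIso ((ay κ K).lanUnit.app M ≫ Functor.whiskerLeft (ay κ K) i.hom) := by
    rw [hi]
    infer_instance
  exact IsIso.of_isIso_comp_right _ (Functor.whiskerLeft (ay κ K) i.hom)

end Extension

end KappaTopos

namespace KappaTopos

/-! ### Sheafification preserves products of fewer than `κ` presheaves. -/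

section Sheafification

variable {C : Type w} [SmallCategory C] {J : GrothendieckTopology C} {I : Type w}

lemma Fan.IsLimit.presheaf_ext {F : I → Cᵒᵖ ⥤ Type w} {c : Fan F} (hc : IsLimit c) {X : C}
    {x y : c.pt.obj (op X)} (h : ∀ i, (c.proj i).app _ x = (c.proj i).app _ y) : x = y :=
  yonedaEquiv.symm.injective (Fan.IsLimit.hom_ext hc _ _ fun i => by
    rw [yonedaEquiv_symm_naturality_right, yonedaEquiv_symm_naturality_right, h])

lemma Fan.IsLimit.exists_presheaf {F : I → Cᵒᵖ ⥤ Type w} {c : Fan F} (hc : IsLimit c) {X : C}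
    (x : ∀ i, (F i).obj (op X)) : ∃ y : c.pt.obj (op X), ∀ i, (c.proj i).app _ y = x i :=
  ⟨yonedaEquiv (Fan.IsLimit.lift hc fun i => yonedaEquiv.symm (x i)), fun i => by
    rw [← yonedaEquiv_comp, Fan.IsLimit.fac, Equiv.apply_symm_apply]⟩

/-- Local injectivity and local surjectivity of the product map are checked on the intersection of
the sieves that witness them for the factors. -/
lemma W_of_isLimit_fan
    (hJ : ∀ ⦃X : C⦄ (S : I → Sieve X), (∀ i, S i ∈ J X) → ⨅ i, S i ∈ J X)
    {F G : I → Cᵒᵖ ⥤ Type w} {f : ∀ i, F i ⟶ G i} (hf : ∀ i, J.W (f i)) {c : Fan F} {d : Fan G}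
    (hc : IsLimit c) (hd : IsLimit d) {q : c.pt ⟶ d.pt}
    (hq : ∀ i, q ≫ d.proj i = c.proj i ≫ f i) : J.W q := by
  have h₁ (i : I) := GrothendieckTopology.W.isLocallyInjective (hf i)
  have h₂ (i : I) := GrothendieckTopology.W.isLocallySurjective (hf i)
  have hq' (i : I) {X : C} (x : c.pt.obj (op X)) :
      (d.proj i).app _ (q.app _ x) = (f i).app _ ((c.proj i).app _ x) :=
    congrArg (fun g : c.pt ⟶ G i => g.app _ x) (hq i)
  rw [GrothendieckTopology.W_iff_isLocallyBijective]
  constructor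
  · refine ⟨fun {X} x y h => J.superset_covering (fun Y g hg => ?_) (hJ (fun i =>
      Presheaf.equalizerSieve (F := F i) (X := X) ((c.proj i).app X x) ((c.proj i).app X y))
        fun i => Presheaf.equalizerSieve_mem J (f i) _ _ ?_)⟩
    · refine Fan.IsLimit.presheaf_ext hc fun i => ?_
      rw [NatTrans.naturality_apply, NatTrans.naturality_apply]
      exact hg _ ⟨i, rfl⟩
    · exact (hq' i x).symm.trans ((congrArg ((d.proj i).app _) h).trans (hq' i y))
  · refine ⟨fun {X} s => J.superset_covering (fun Y g hg => ?_) (hJ (fun i =>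
      Presheaf.imageSieve (f i) ((d.proj i).app _ s)) fun i => Presheaf.imageSieve_mem J (f i) _)⟩
    choose t ht using fun i => hg _ ⟨i, rfl⟩
    obtain ⟨y, hy⟩ := Fan.IsLimit.exists_presheaf hc t
    refine ⟨y, Fan.IsLimit.presheaf_ext hd fun i => ?_⟩
    rw [NatTrans.naturality_apply]
    exact (hq' i y).trans ((congrArg _ (hy i)).trans (ht i))

/-- The transpose `q` of the comparison is the product of the sheafification units, hence a local
isomorphism. The comparison is the sheafification of `q` followed by an invertible counit. -/
lemma isIso_piComparison_presheafToSheaf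
    (hJ : ∀ ⦃X : C⦄ (S : I → Sieve X), (∀ i, S i ∈ J X) → ⨅ i, S i ∈ J X)
    (F : I → Cᵒᵖ ⥤ Type w) : IsIso (piComparison (presheafToSheaf J (Type w)) F) := by
  let adj := sheafificationAdjunction J (Type w)
  let q := adj.homEquiv _ _ (piComparison (presheafToSheaf J (Type w)) F)
  have hq : J.W q := by
    refine W_of_isLimit_fan hJ (fun i => J.W_toSheafify (F i)) (limit.isLimit _)
      (isLimitOfHasProductOfPreservesLimit (sheafToPresheaf J (Type w))
        fun i => (presheafToSheaf J (Type w)).obj (F i)) fun i => ?_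
    refine (adj.homEquiv_naturality_right _ (Pi.π _ i)).symm.trans ?_
    rw [piComparison_comp_π, ← Category.comp_id ((presheafToSheaf J (Type w)).map _),
      adj.homEquiv_naturality_left]
    exact congrArg (Pi.π F i ≫ ·) (adj.homEquiv_id _)
  have := (J.W_iff q).1 hq
  have h : piComparison (presheafToSheaf J (Type w)) F = (adj.homEquiv _ _).symm q :=
    ((adj.homEquiv _ _).symm_apply_apply _).symm
  rw [h, adj.homEquiv_counit]
  infer_instance

end Sheafification

/-! ### Restriction along `ay` and the equivalence. -/

section Site

variable {κ : Cardinal.{w}} [Fact κ.IsRegular] {C : Type w} [SmallCategory C] {K : Precoverage C}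

lemma IsKappaSite.isLexFunctor_presheafToSheaf (hK : IsKappaSite κ K) :
    IsLexFunctor κ (presheafToSheaf (topology κ K) (Type w)) := by
  have : IsLexCategory κ (Cᵒᵖ ⥤ Type w) := ⟨fun _ _ _ => inferInstance⟩
  have := hK.isLexCategory
  have := IsLexCategory.hasFiniteLimits κ C
  have := hK.hasIsos_pullbackClosure
  refine isLexFunctor_of_preservesProducts fun I hI => ?_
  have hJ ⦃X : C⦄ (S : I → Sieve X) (hS : ∀ i, S i ∈ topology κ K X) :
      ⨅ i, S i ∈ topology κ K X := by
    rw [hK.topology_eq] at hS ⊢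
    exact iInf_mem_treeTopology hI hS
  have (F : I → (Cᵒᵖ ⥤ Type w)) :
      PreservesLimit (Discrete.functor F) (presheafToSheaf (topology κ K) (Type w)) := by
    have := isIso_piComparison_presheafToSheaf hJ F
    exact PreservesProduct.of_iso_comparison _ _
  exact preservesLimitsOfShape_of_discrete _

lemma IsKappaSite.isLexFunctor_ay (hK : IsKappaSite κ K) : IsLexFunctor κ (ay κ K) :=
  isLexFunctor_yoneda.comp hK.isLexFunctor_presheafToSheaf

variable {E : Type u} [Category.{w} E]

/-- Since `C` is small, the index type can be taken in `Type w`, where the vertices of trees live.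
-/
lemma Presieve.exists_eq_ofArrows {X : C} (R : Presieve X) :
    ∃ (ι : Type w) (Y : ι → C) (f : ∀ i, Y i ⟶ X), R = Presieve.ofArrows Y f := by
  refine ⟨Σ Y : C, {f : Y ⟶ X // R f}, fun i => i.1, fun i => i.2.1, ?_⟩
  refine le_antisymm (fun Y f hf => ?_) (Presieve.ofArrows_le_iff.2 fun i => i.2.2)
  exact Presieve.ofArrows.mk (ι := Σ Y : C, {f : Y ⟶ X // R f}) (Y := fun i => i.1)
    (f := fun i => i.2.1) ⟨Y, f, hf⟩

lemma IsKappaSite.generate_mem_topology (hK : IsKappaSite κ K) {X : C} {R : Presieve X}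
    (hR : R ∈ K X) : Sieve.generate R ∈ topology κ K X := by
  have := hK.isLexCategory
  have := IsLexCategory.hasFiniteLimits κ C
  have := hK.hasIsos_pullbackClosure
  rw [hK.topology_eq]
  obtain ⟨ι, Y, f, rfl⟩ := Presieve.exists_eq_ofArrows R
  exact generate_mem_treeTopology (le_pullbackClosure _ hR)

/-- The sieve generated by `R`, as a presheaf, is the colimit of its elements, and `a ⋙ N` preserves
this colimit and inverts the inclusion of the sieve. Each element factors through a member of `R`.
-/
lemma IsKappaSite.preservesFamilies_ay_comp (hK : IsKappaSite κ K) {N : Sh κ K ⥤ E}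
    (hN : IsCocontinuous.{w} N) : PreservesFamilies K (ay κ K ⋙ N) := fun X R hR => by
  obtain ⟨_⟩ := hN
  let a := presheafToSheaf (topology κ K) (Type w)
  have : PreservesColimitsOfSize.{w, w} a :=
    (sheafificationAdjunction _ (Type w)).leftAdjoint_preservesColimits
  have hS := hK.generate_mem_topology hR
  have : IsIso (a.map (Sieve.generate R).functorInclusion) :=
    (GrothendieckTopology.W_iff _ _).1 (functorInclusion_mem_W hS)
  have : IsIso ((a ⋙ N).map (Sieve.generate R).functorInclusion) :=
    inferInstanceAs (IsIso (N.map (a.map _)))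
  refine (isExtremalEpic_elements (L := a ⋙ N) (Sieve.generate R).functor).of_iso
    (asIso ((a ⋙ N).map (Sieve.generate R).functorInclusion)) ?_
  rintro _ _ ⟨j⟩
  obtain ⟨Y, b, f, hf, hbf⟩ := (yonedaEquiv j.hom).2
  refine ⟨_, (ay κ K ⋙ N).map b, _, Presieve.map_map hf, ?_⟩
  have h : yoneda.map b ≫ yoneda.map f = j.hom ≫ (Sieve.generate R).functorInclusion := by
    rw [← Functor.map_comp, hbf]
    apply yonedaEquiv.injective
    rw [yonedaEquiv_yoneda_map, yonedaEquiv_comp]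
    rfl
  exact ((a ⋙ N).map_comp _ _).symm.trans ((congrArg (a ⋙ N).map h).trans ((a ⋙ N).map_comp _ _))

theorem isModel_ay_comp (hK : IsKappaSite κ K) {N : Sh κ K ⥤ E}
    (hN : isLexCocontinuous κ E (Sh κ K) N) : isModel κ K E (ay κ K ⋙ N) :=
  ⟨hK.isLexFunctor_ay.comp hN.1, hK.preservesFamilies_ay_comp hN.2⟩

/-- The adjunction between Kan extension and restriction passes to the full subcategories. Its unit
is invertible on models, and its counit on cocontinuous functors since these are Kan extensions of
their restrictions. -/
theorem exists_equivalence [IsGrothendieckTopos E] (hK : IsKappaSite κ K)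
    (hE : IsInftyCoherent κ E)
    (hlan : ∀ M : Mod κ K E, isLexCocontinuous κ E (Sh κ K) ((ay κ K).lan.obj M.obj))
    (hres : ∀ N : FunStar κ E (Sh κ K), isModel κ K E (ay κ K ⋙ N.obj)) :
    ∃ e : Mod κ K E ≌ FunStar κ E (Sh κ K),
      e.functor = ObjectProperty.lift _ (ObjectProperty.ι _ ⋙ (ay κ K).lan) hlan ∧
      e.inverse = ObjectProperty.lift _
        (ObjectProperty.ι _ ⋙ (Functor.whiskeringLeft _ _ E).obj (ay κ K)) hres := by
  let F : Mod κ K E ⥤ FunStar κ E (Sh κ K) :=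
    ObjectProperty.lift _ (ObjectProperty.ι _ ⋙ (ay κ K).lan) hlan
  let G : FunStar κ E (Sh κ K) ⥤ Mod κ K E := ObjectProperty.lift _
    (ObjectProperty.ι _ ⋙ (Functor.whiskeringLeft _ _ E).obj (ay κ K)) hres
  let adj : F ⊣ G := ((ay κ K).lanAdjunction E).restrictFullyFaithful
    (ObjectProperty.fullyFaithfulι _) (ObjectProperty.fullyFaithfulι _) (Iso.refl _) (Iso.refl _)
  have h₁ (M : Mod κ K E) : IsIso (adj.unit.app M) := by
    have : IsIso ((ay κ K).lanUnit.app M.obj) :=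
      (isIso_lanUnit_app hK hE M.property.1 M.property.2).1
    have : IsIso ((ObjectProperty.ι _).map (adj.unit.app M)) := by
      rw [Adjunction.map_restrictFullyFaithful_unit_app, Functor.lanAdjunction_unit]
      exact IsIso.comp_isIso' this inferInstance
    exact isIso_of_reflects_iso _ (ObjectProperty.ι _)
  have h₂ (N : FunStar κ E (Sh κ K)) : IsIso (adj.counit.app N) := by
    have : IsIso (((ay κ K).lanAdjunction E).counit.app N.obj) :=
      (Functor.isIso_lanAdjunction_counit_app_iff _ _).2
        (isLeftKanExtension_of_isCocontinuous N.property.2)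
    have : IsIso ((ObjectProperty.ι _).map (adj.counit.app N)) := by
      rw [Adjunction.map_restrictFullyFaithful_counit_app]
      exact IsIso.comp_isIso' inferInstance (IsIso.comp_isIso' inferInstance this)
    exact isIso_of_reflects_iso _ (ObjectProperty.ι _)
  exact ⟨adj.toEquivalence, rfl, rfl⟩

end Site

end KappaTopos

theorem mainTheorem5 (κ : Cardinal.{w}) [Fact κ.IsRegular]
    {C : Type w} [SmallCategory C] (K : Precoverage C) (hK : KappaTopos.IsKappaSite κ K)
    {E : Type u} [Category.{w} E] [KappaTopos.IsGrothendieckTopos E]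
    (hE : KappaTopos.IsInftyCoherent κ E) :
    (∀ M : C ⥤ E, KappaTopos.IsLexFunctor κ M → KappaTopos.PreservesFamilies K M →
      IsIso ((KappaTopos.ay κ K).lanUnit.app M) ∧
        KappaTopos.IsLexFunctor κ ((KappaTopos.ay κ K).lan.obj M) ∧
        KappaTopos.IsCocontinuous.{w} ((KappaTopos.ay κ K).lan.obj M)) ∧
    ∃ (hlan : ∀ M : KappaTopos.Mod κ K E,
        KappaTopos.isLexCocontinuous κ E (KappaTopos.Sh κ K) ((KappaTopos.ay κ K).lan.obj M.obj))
      (hres : ∀ N : KappaTopos.FunStar κ E (KappaTopos.Sh κ K),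
        KappaTopos.isModel κ K E (KappaTopos.ay κ K ⋙ N.obj))
      (e : KappaTopos.Mod κ K E ≌ KappaTopos.FunStar κ E (KappaTopos.Sh κ K)),
        e.functor = ObjectProperty.lift _
          (ObjectProperty.ι _ ⋙ (KappaTopos.ay κ K).lan) hlan ∧
        e.inverse = ObjectProperty.lift _
          (ObjectProperty.ι _ ⋙ (Functor.whiskeringLeft _ _ E).obj (KappaTopos.ay κ K)) hres := by
  refine ⟨fun M hM hKM => KappaTopos.isIso_lanUnit_app hK hE hM hKM, ?_⟩
  have hlan (M : KappaTopos.Mod κ K E) :=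
    (KappaTopos.isIso_lanUnit_app hK hE M.property.1 M.property.2).2
  have hres (N : KappaTopos.FunStar κ E (KappaTopos.Sh κ K)) :=
    KappaTopos.isModel_ay_comp hK N.property
  exact ⟨hlan, hres, KappaTopos.exists_equivalence hK hE hlan hres⟩
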